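/- Let $n\ge 3$ and let $(M,g)$ be a smooth $n$-dimensional Riemannian manifold with Levi-Civita connection $\nabla$; write $T_{ij;k}$ for the components of $\nabla T$, $\mathsf{Ri}_{jk}=R^i{}_{ijk}$ for the Ricci tensor and $\mathsf{sc}=g^{jk}\mathsf{Ri}_{jk}$ for the scalar curvature. A function or one form on $M$ is called \emph{nonzero} if it does not vanish identically on any connected component of $M$ (for connected $M$: if it is not identically zero). All functions and one forms are smooth. \begin{itemize} \item $\mathsf{Ri}$ is \emph{pseudo Ricci symmetric} if there is a nonzero one form $\alpha$ with $\mathsf{Ri}_{ij;\ell}=2\alpha_\ell\mathsf{Ri}_{ij}+\alpha_i\mathsf{Ri}_{\ell j}+\alpha_j\mathsf{Ri}_{i\ell}$. \item $\mathsf{Ri}$ is \emph{quasi Einstein} if there are functions $a,b$ and a nowhere vanishing one form $\omega$ with $\mathsf{Ri}=a\,g+b\,\frac{\omega\otimes\omega}{|\omega|^2}$. \item The \emph{Cotton tensor} is $C_{ijk}=S_{ij;k}-S_{ik;j}$, where $S=\mathsf{Ri}-\frac{\mathsf{sc}}{2n-2}\,g$. \end{itemize} Suppose that $\mathsf{Ri}$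 is pseudo Ricci symmetric and that $\mathsf{sc}$ is nonzero. Then: \begin{itemize} \item[(i)] if $\mathsf{Ri}$ is also quasi Einstein for some $a,b,\omega$ with $a$ nonzero, then $C=0$ on $M$; \item[(ii)] if $C=0$ on $M$, then $\mathsf{Ri}$ is quasi Einstein. \end{itemize} -/

import Mathlib

open Bundle
open scoped Manifold ContDiff

namespace RicciClasses

noncomputable section

/-! ### Tensor calculus in coordinates

`G : EuclideanSpace ℝ (Fin n) → Matrix (Fin n) (Fin n) ℝ` is the coefficient matrix `g_{ij}` of a
metric, as a function of the coordinates. -/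

/-- The partial derivative `∂_i f` at `u`. -/
def pderiv {n : ℕ} (i : Fin n) (f : EuclideanSpace ℝ (Fin n) → ℝ)
    (u : EuclideanSpace ℝ (Fin n)) : ℝ :=
  fderiv ℝ f u (EuclideanSpace.single i (1 : ℝ))

/-- The Christoffel symbol `Γ^k_{ij}` of the Levi-Civita connection. -/
def christoffel {n : ℕ} (G : EuclideanSpace ℝ (Fin n) → Matrix (Fin n) (Fin n) ℝ)
    (k i j : Fin n) (u : EuclideanSpace ℝ (Fin n)) : ℝ :=
  (1 / 2 : ℝ) * ∑ l, (G u)⁻¹ k l *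
    (pderiv i (fun v => G v j l) u + pderiv j (fun v => G v i l) u
      - pderiv l (fun v => G v i j) u)

/-- The curvature tensor `R^l_{ijk}`, that is `R(∂_i, ∂_j) ∂_k = R^l_{ijk} ∂_l` with
`R(X, Y) Z = ∇_X ∇_Y Z - ∇_Y ∇_X Z - ∇_{[X, Y]} Z`. -/
def riemann {n : ℕ} (G : EuclideanSpace ℝ (Fin n) → Matrix (Fin n) (Fin n) ℝ)
    (l i j k : Fin n) (u : EuclideanSpace ℝ (Fin n)) : ℝ :=
  pderiv i (christoffel G l j k) u - pderiv j (christoffel G l i k) u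
    + ∑ m, (christoffel G m j k u * christoffel G l i m u
        - christoffel G m i k u * christoffel G l j m u)

/-- The Ricci tensor `Ri_{jk} = R^i_{ijk}`. -/
def ricci {n : ℕ} (G : EuclideanSpace ℝ (Fin n) → Matrix (Fin n) (Fin n) ℝ)
    (j k : Fin n) (u : EuclideanSpace ℝ (Fin n)) : ℝ :=
  ∑ i, riemann G i i j k u

/-- The scalar curvature `sc = g^{jk} Ri_{jk}` in coordinates. -/
def scalar {n : ℕ} (G : EuclideanSpace ℝ (Fin n) → Matrix (Fin n) (Fin n) ℝ)
    (u : EuclideanSpace ℝ (Fin n)) : ℝ :=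
  ∑ j, ∑ k, (G u)⁻¹ j k * ricci G j k u

/-- The covariant derivative `T_{ij;k} = (∇_{∂_k} T)(∂_i, ∂_j)` of a tensor of type `(0,2)`. -/
def covDeriv {n : ℕ} (G : EuclideanSpace ℝ (Fin n) → Matrix (Fin n) (Fin n) ℝ)
    (T : Fin n → Fin n → EuclideanSpace ℝ (Fin n) → ℝ)
    (i j k : Fin n) (u : EuclideanSpace ℝ (Fin n)) : ℝ :=
  pderiv k (T i j) u
    - ∑ m, (christoffel G m k i u * T m j u + christoffel G m k j u * T i m u)

/-- The Schouten tensor `S = Ri - sc / (2n - 2) g`. -/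
def schouten {n : ℕ} (G : EuclideanSpace ℝ (Fin n) → Matrix (Fin n) (Fin n) ℝ)
    (i j : Fin n) (u : EuclideanSpace ℝ (Fin n)) : ℝ :=
  ricci G i j u - scalar G u / (2 * (n : ℝ) - 2) * G u i j

/-- The Cotton tensor `C_{ijk} = S_{ij;k} - S_{ik;j}`. -/
def cotton {n : ℕ} (G : EuclideanSpace ℝ (Fin n) → Matrix (Fin n) (Fin n) ℝ)
    (i j k : Fin n) (u : EuclideanSpace ℝ (Fin n)) : ℝ :=
  covDeriv G (schouten G) i j k u - covDeriv G (schouten G) i k j u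

/-! ### Riemannian manifolds

`M` is a smooth manifold modelled on `EuclideanSpace ℝ (Fin n)`, a coordinate system is an element
`e` of its maximal smooth atlas, and its coordinate domain is `e.target`. -/

variable {n : ℕ} {M : Type*} [TopologicalSpace M] [ChartedSpace (EuclideanSpace ℝ (Fin n)) M]

/-- The coordinate vector `∂_i` of the coordinate system `e`, at the point with coordinates `u`. -/
def coordVec (e : OpenPartialHomeomorph M (EuclideanSpace ℝ (Fin n))) (i : Fin n)
    (u : EuclideanSpace ℝ (Fin n)) : TangentSpace (𝓡 n) (e.symm u) :=
  mfderiv (𝓡 n) (𝓡 n) e.symm u (EuclideanSpace.single i (1 : ℝ) : EuclideanSpace ℝ (Fin n))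

/-- The component `α_i = α(∂_i)` of a one form in the coordinate system `e`. -/
def formCoeff (α : (x : M) → TangentSpace (𝓡 n) x →L[ℝ] ℝ)
    (e : OpenPartialHomeomorph M (EuclideanSpace ℝ (Fin n))) (i : Fin n)
    (u : EuclideanSpace ℝ (Fin n)) : ℝ :=
  α (e.symm u) (coordVec e i u)

/-- A one form is smooth (as a section of the cotangent bundle). -/
def SmoothForm [IsManifold (𝓡 n) ∞ M] (α : (x : M) → TangentSpace (𝓡 n) x →L[ℝ] ℝ) : Prop :=
  ContMDiff (𝓡 n) ((𝓡 n).prod 𝓘(ℝ, EuclideanSpace ℝ (Fin n) →L[ℝ] ℝ)) ∞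
    (fun x : M => TotalSpace.mk' (EuclideanSpace ℝ (Fin n) →L[ℝ] ℝ)
      (E := fun x : M => TangentSpace (𝓡 n) x →L[ℝ] ℝ) x (α x))

/-- `P` holds somewhere on every connected component. With `P x` the statement that a tensor does
not vanish at `x`, this says that the tensor is not identically zero on any component. -/
def SomewhereOnComponents (P : M → Prop) : Prop :=
  ∀ x : M, ∃ y ∈ connectedComponent x, P y

variable [IsManifold (𝓡 n) ∞ M]
  (g : ContMDiffRiemannianMetric (𝓡 n) ∞ (EuclideanSpace ℝ (Fin n))
    (fun x : M => TangentSpace (𝓡 n) x))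

/-- The matrix `g_{ij} = g(∂_i, ∂_j)` of the metric in the coordinate system `e`. -/
def metricCoeff (e : OpenPartialHomeomorph M (EuclideanSpace ℝ (Fin n)))
    (u : EuclideanSpace ℝ (Fin n)) : Matrix (Fin n) (Fin n) ℝ :=
  Matrix.of fun i j => g.inner (e.symm u) (coordVec e i u) (coordVec e j u)

/-- The scalar curvature as a function on `M`: its value at `x` is computed in the preferred chart
at `x` (it would be the same in any other coordinate system). -/
def scalarCurvature (x : M) : ℝ :=
  scalar (metricCoeff g (chartAt (EuclideanSpace ℝ (Fin n)) x))
    (chartAt (EuclideanSpace ℝ (Fin n)) x x)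

/-- `|η|² = g^{ij} η_i η_j` in the coordinate system `e`. -/
def formNormSq (η : (x : M) → TangentSpace (𝓡 n) x →L[ℝ] ℝ)
    (e : OpenPartialHomeomorph M (EuclideanSpace ℝ (Fin n)))
    (u : EuclideanSpace ℝ (Fin n)) : ℝ :=
  ∑ i, ∑ j, (metricCoeff g e u)⁻¹ i j * formCoeff η e i u * formCoeff η e j u

/-- The Ricci tensor is pseudo Ricci symmetric: there is a nonzero one form `α` with
`Ri_{ij;l} = 2 α_l Ri_{ij} + α_i Ri_{lj} + α_j Ri_{il}`. -/
def PseudoRicciSymmetric : Prop :=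
  ∃ α : (x : M) → TangentSpace (𝓡 n) x →L[ℝ] ℝ,
    SmoothForm α ∧ SomewhereOnComponents (fun x => α x ≠ 0) ∧
    ∀ e ∈ IsManifold.maximalAtlas (𝓡 n) ∞ M, ∀ u ∈ e.target, ∀ i j l : Fin n,
      covDeriv (metricCoeff g e) (ricci (metricCoeff g e)) i j l u =
        2 * formCoeff α e l u * ricci (metricCoeff g e) i j u
          + formCoeff α e i u * ricci (metricCoeff g e) l j u
          + formCoeff α e j u * ricci (metricCoeff g e) i l u

/-- The quasi Einstein equation `Ri = a g + b (η ⊗ η) / |η|²` with smooth functions `a`, `b` and a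
smooth one form `η`, which is nowhere zero because of the denominator. -/
def QuasiEinsteinWith (a b : M → ℝ) (η : (x : M) → TangentSpace (𝓡 n) x →L[ℝ] ℝ) : Prop :=
  ContMDiff (𝓡 n) 𝓘(ℝ, ℝ) ∞ a ∧ ContMDiff (𝓡 n) 𝓘(ℝ, ℝ) ∞ b ∧ SmoothForm η ∧
  (∀ x, η x ≠ 0) ∧
  ∀ e ∈ IsManifold.maximalAtlas (𝓡 n) ∞ M, ∀ u ∈ e.target, ∀ i j : Fin n,
    ricci (metricCoeff g e) i j u =
      a (e.symm u) * metricCoeff g e u i j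
        + b (e.symm u) * (formCoeff η e i u * formCoeff η e j u / formNormSq g η e u)

/-- The Ricci tensor is quasi Einstein. -/
def QuasiEinstein : Prop := ∃ a b η, QuasiEinsteinWith g a b η

/-- The Cotton tensor vanishes identically. -/
def CottonFlat : Prop :=
  ∀ e ∈ IsManifold.maximalAtlas (𝓡 n) ∞ M, ∀ u ∈ e.target, ∀ i j k : Fin n,
    cotton (metricCoeff g e) i j k u = 0

end

end RicciClasses

/-! Write α for the one form, α^♯ for the dual vector, Ri(α) for Ri(α^♯, ·), and ρ = sc/(n-1).
Tracing the pseudo Ricci symmetric equation gives d sc = 2 sc α + 2 Ri(α), while its divergence and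
`contracted_bianchi` give d sc = 2 sc α + 6 Ri(α). Hence Ri(α) = 0 (`sum_ricci_mul_raise`). It
follows that d sc = 2 sc α, d|Ri|² = 4 |Ri|² α and C_ijk = α_k (Ri - ρ g)_ij - α_j (Ri - ρ g)_ik
(`pderiv_scalar`, `pderiv_ricciNormSq`, `cotton_eq`).

The global ingredient is that a solution of df = f β has a clopen zero set, by a Grönwall estimate
along segments (`isClopen_of_pderiv_eq_mul`). A solution that is nonzero somewhere on every
component therefore vanishes nowhere. This applies at once to sc; since sc is computed in a chart
varying with the point, its invariance under coordinate changes is needed (`scalarCurvature_eq`).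

(i) If Ri = a g + b η⊗η/|η|², then |Ri|² - sc² = -(n-1) a (na + 2b) solves df = 4 f α, so {a (na +
2b) = 0} is clopen. The factors a and na + 2b have no common zero, since there sc = na + b would
vanish. So {a = 0} is clopen, hence empty. Where α ≠ 0, the equation Ri(α) = 0 now forces α to be
parallel to η and a + b = 0. Then ρ = a, so Ri - ρ g is a multiple of α⊗α and C = 0. Where α = 0,
the formula for C is zero.

(ii) If C = 0, contracting its formula with α gives |α|² Ri = ρ (|α|² g - α⊗α), which is quasi
Einstein wherever α ≠ 0. It remains to exclude zeros of α. Where α ≠ 0, differentiating Ri(α) = 0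
and using that α is closed gives ∇α = -|α|² g + e α⊗α for some function e (`normSq_sq_mul_covForm`).
The Ricci identity, contracted with Ri(α) = 0, forces e = 2 (`eq_two_of_covForm_eq`). Thus d|α|² = 2
|α|² α, trivially also where α = 0, and the zero set of α is clopen, hence empty. -/

namespace RicciClasses

/-! ### Partial derivatives -/

section Calculus

variable {n : ℕ} {O : Set (EuclideanSpace ℝ (Fin n))} {u : EuclideanSpace ℝ (Fin n)}
  {f h : EuclideanSpace ℝ (Fin n) → ℝ}

lemma pderiv_const (i : Fin n) (c : ℝ) (u : EuclideanSpace ℝ (Fin n)) :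
    pderiv i (fun _ => c) u = 0 := by
  simp [pderiv]

lemma pderiv_add (i : Fin n) (hf : DifferentiableAt ℝ f u) (hh : DifferentiableAt ℝ h u) :
    pderiv i (fun v => f v + h v) u = pderiv i f u + pderiv i h u := by
  simp [pderiv, fderiv_fun_add hf hh]

lemma pderiv_sub (i : Fin n) (hf : DifferentiableAt ℝ f u) (hh : DifferentiableAt ℝ h u) :
    pderiv i (fun v => f v - h v) u = pderiv i f u - pderiv i h u := by
  simp [pderiv, fderiv_fun_sub hf hh]

lemma pderiv_mul (i : Fin n) (hf : DifferentiableAt ℝ f u) (hh : DifferentiableAt ℝ h u) :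
    pderiv i (fun v => f v * h v) u = pderiv i f u * h u + f u * pderiv i h u := by
  simp [pderiv, fderiv_fun_mul hf hh]
  ring

lemma pderiv_const_mul (i : Fin n) (c : ℝ) (hf : DifferentiableAt ℝ f u) :
    pderiv i (fun v => c * f v) u = c * pderiv i f u := by
  rw [pderiv_mul i (differentiableAt_const c) hf, pderiv_const]
  ring

lemma pderiv_sum {ι : Type*} (s : Finset ι) {F : ι → EuclideanSpace ℝ (Fin n) → ℝ} (i : Fin n)
    (hF : ∀ j ∈ s, DifferentiableAt ℝ (F j) u) :
    pderiv i (fun v => ∑ j ∈ s, F j v) u = ∑ j ∈ s, pderiv i (F j) u := by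
  simp [pderiv, fderiv_fun_sum hF]

lemma pderiv_congr (i : Fin n) (hO : IsOpen O) (hu : u ∈ O) (hfh : ∀ v ∈ O, f v = h v) :
    pderiv i f u = pderiv i h u := by
  have : f =ᶠ[nhds u] h := Filter.eventuallyEq_of_mem (hO.mem_nhds hu) hfh
  simp [pderiv, this.fderiv_eq]

lemma _root_.ContDiffOn.diffAt_of_isOpen (hf : ContDiffOn ℝ ∞ f O) (hO : IsOpen O) (hu : u ∈ O) :
    DifferentiableAt ℝ f u :=
  (hf.contDiffAt (hO.mem_nhds hu)).differentiableAt (by simp)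

lemma contDiffOn_pderiv (hO : IsOpen O) (hf : ContDiffOn ℝ ∞ f O) (i : Fin n) :
    ContDiffOn ℝ ∞ (pderiv i f) O :=
  (hf.fderiv_of_isOpen hO (m := ∞) (by simp)).clm_apply contDiffOn_const

lemma pderiv_comm (hO : IsOpen O) (hu : u ∈ O) (hf : ContDiffOn ℝ ∞ f O) (i j : Fin n) :
    pderiv i (pderiv j f) u = pderiv j (pderiv i f) u := by
  have hfu : ContDiffAt ℝ ∞ f u := hf.contDiffAt (hO.mem_nhds hu)
  have hd : DifferentiableAt ℝ (fderiv ℝ f) u :=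
    (hfu.fderiv_right (m := 1) (by norm_cast)).differentiableAt (by simp)
  have key : ∀ k l : Fin n, pderiv k (pderiv l f) u =
      fderiv ℝ (fderiv ℝ f) u (EuclideanSpace.single k 1) (EuclideanSpace.single l 1) := by
    intro k l
    unfold pderiv
    rw [fderiv_clm_apply hd (differentiableAt_const _)]
    simp
  rw [key, key]
  exact (hfu.isSymmSndFDerivAt (by simp only [minSmoothness_of_isRCLikeNormedField]; exact ENat.LEInfty.out)) _ _

lemma fderiv_apply_eq_sum (f : EuclideanSpace ℝ (Fin n) → ℝ) (u v : EuclideanSpace ℝ (Fin n)) :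
    fderiv ℝ f u v = ∑ i, v i * pderiv i f u := by
  conv_lhs => rw [← (EuclideanSpace.basisFun (Fin n) ℝ).sum_repr v]
  simp [pderiv]

/-! ### Matrix valued functions -/

variable {X Y : EuclideanSpace ℝ (Fin n) → Matrix (Fin n) (Fin n) ℝ}

/-- The entrywise partial derivative of a matrix valued function. -/
noncomputable def mderiv (i : Fin n) (X : EuclideanSpace ℝ (Fin n) → Matrix (Fin n) (Fin n) ℝ)
    (u : EuclideanSpace ℝ (Fin n)) : Matrix (Fin n) (Fin n) ℝ :=
  Matrix.of fun a b => pderiv i (fun v => X v a b) u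

/-- All entries of a matrix valued function are smooth on `O`. -/
def MSmooth (O : Set (EuclideanSpace ℝ (Fin n)))
    (X : EuclideanSpace ℝ (Fin n) → Matrix (Fin n) (Fin n) ℝ) : Prop :=
  ∀ a b, ContDiffOn ℝ ∞ (fun v => X v a b) O

/-- All entries of a matrix valued function are differentiable at `u`. -/
def EntryDiffAt (X : EuclideanSpace ℝ (Fin n) → Matrix (Fin n) (Fin n) ℝ)
    (u : EuclideanSpace ℝ (Fin n)) : Prop :=
  ∀ a b, DifferentiableAt ℝ (fun v => X v a b) u

lemma MSmooth.entryDiffAt (hX : MSmooth O X) (hO : IsOpen O) (hu : u ∈ O) : EntryDiffAt X u :=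
  fun a b => (hX a b).diffAt_of_isOpen hO hu

lemma MSmooth.mono {O' : Set (EuclideanSpace ℝ (Fin n))} (hX : MSmooth O X) (h : O' ⊆ O) :
    MSmooth O' X :=
  fun a b => (hX a b).mono h

lemma MSmooth.add (hX : MSmooth O X) (hY : MSmooth O Y) : MSmooth O (fun v => X v + Y v) :=
  fun a b => (hX a b).add (hY a b)

lemma MSmooth.sub (hX : MSmooth O X) (hY : MSmooth O Y) : MSmooth O (fun v => X v - Y v) :=
  fun a b => (hX a b).sub (hY a b)

lemma MSmooth.mul (hX : MSmooth O X) (hY : MSmooth O Y) : MSmooth O (fun v => X v * Y v) := by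
  intro a b
  simp only [Matrix.mul_apply]
  exact ContDiffOn.sum fun c _ => (hX a c).mul (hY c b)

lemma MSmooth.mderiv (hX : MSmooth O X) (hO : IsOpen O) (i : Fin n) : MSmooth O (mderiv i X) :=
  fun a b => contDiffOn_pderiv hO (hX a b) i

lemma MSmooth.det (hX : MSmooth O X) : ContDiffOn ℝ ∞ (fun v => (X v).det) O := by
  simp only [Matrix.det_apply']
  exact ContDiffOn.sum fun σ _ => contDiffOn_const.mul (contDiffOn_prod fun c _ => hX _ _)

/-- Cramer's rule: an adjugate entry is the determinant of the matrix with one row replaced by a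
constant unit vector, so it is polynomial in the entries. -/
lemma MSmooth.inv (hX : MSmooth O X) (hdet : ∀ v ∈ O, (X v).det ≠ 0) :
    MSmooth O (fun v => (X v)⁻¹) := by
  intro a b
  have hadj : ContDiffOn ℝ ∞ (fun v => (X v).adjugate a b) O := by
    simp only [Matrix.adjugate_apply]
    refine MSmooth.det (X := fun v => (X v).updateRow b (Pi.single a 1)) fun c d => ?_
    by_cases hc : c = b
    · subst hc
      simpa using contDiffOn_const
    · simpa [Matrix.updateRow_ne hc] using hX c d
  have : ∀ v, (X v)⁻¹ a b = ((X v).det)⁻¹ * (X v).adjugate a b := by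
    intro v
    simp [Matrix.inv_def]
  simp only [this]
  exact (hX.det.inv hdet).mul hadj

lemma mderiv_add (i : Fin n) (hX : EntryDiffAt X u) (hY : EntryDiffAt Y u) :
    mderiv i (fun v => X v + Y v) u = mderiv i X u + mderiv i Y u := by
  ext a b
  exact pderiv_add i (hX a b) (hY a b)

lemma mderiv_sub (i : Fin n) (hX : EntryDiffAt X u) (hY : EntryDiffAt Y u) :
    mderiv i (fun v => X v - Y v) u = mderiv i X u - mderiv i Y u := by
  ext a b
  exact pderiv_sub i (hX a b) (hY a b)

lemma mderiv_transpose (i : Fin n) :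
    mderiv i (fun v => (X v).transpose) u = (mderiv i X u).transpose := rfl

lemma mderiv_const (i : Fin n) (C : Matrix (Fin n) (Fin n) ℝ) :
    mderiv i (fun _ => C) u = 0 := by
  ext a b
  exact pderiv_const i _ u

lemma mderiv_mul (i : Fin n) (hX : EntryDiffAt X u) (hY : EntryDiffAt Y u) :
    mderiv i (fun v => X v * Y v) u = mderiv i X u * Y u + X u * mderiv i Y u := by
  ext a b
  simp only [mderiv, Matrix.mul_apply, Matrix.add_apply, Matrix.of_apply]
  rw [pderiv_sum _ _ fun c _ => (hX a c).fun_mul (hY c b), ← Finset.sum_add_distrib]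
  exact Finset.sum_congr rfl fun c _ => pderiv_mul i (hX a c) (hY c b)

lemma mderiv_congr (i : Fin n) (hO : IsOpen O) (hu : u ∈ O) (hXY : ∀ v ∈ O, X v = Y v) :
    mderiv i X u = mderiv i Y u := by
  ext a b
  exact pderiv_congr i hO hu fun v hv => by rw [hXY v hv]

lemma mderiv_comm (hO : IsOpen O) (hu : u ∈ O) (hX : MSmooth O X) (i j : Fin n) :
    mderiv i (mderiv j X) u = mderiv j (mderiv i X) u := by
  ext a b
  exact pderiv_comm hO hu (hX a b) i j

lemma EntryDiffAt.mul (hX : EntryDiffAt X u) (hY : EntryDiffAt Y u) : EntryDiffAt (fun v => X v * Y v) u := by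
  intro a b
  simp only [Matrix.mul_apply]
  exact DifferentiableAt.fun_sum fun c _ => (hX a c).mul (hY c b)

lemma EntryDiffAt.add (hX : EntryDiffAt X u) (hY : EntryDiffAt Y u) : EntryDiffAt (fun v => X v + Y v) u :=
  fun a b => (hX a b).add (hY a b)

lemma EntryDiffAt.sub (hX : EntryDiffAt X u) (hY : EntryDiffAt Y u) : EntryDiffAt (fun v => X v - Y v) u :=
  fun a b => (hX a b).sub (hY a b)

lemma EntryDiffAt.transpose (hX : EntryDiffAt X u) : EntryDiffAt (fun v => (X v).transpose) u :=
  fun a b => hX b a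

end Calculus

/-! ### The Levi-Civita connection and its curvature as matrices -/

section Connection

variable {n : ℕ} {O : Set (EuclideanSpace ℝ (Fin n))} {u : EuclideanSpace ℝ (Fin n)}
  {G : EuclideanSpace ℝ (Fin n) → Matrix (Fin n) (Fin n) ℝ}

open Matrix

/-- `G` is a smooth Riemannian metric in coordinates on the open set `O`. -/
structure IsMetricOn (O : Set (EuclideanSpace ℝ (Fin n)))
    (G : EuclideanSpace ℝ (Fin n) → Matrix (Fin n) (Fin n) ℝ) : Prop where
  isOpen : IsOpen O
  smooth : MSmooth O G
  posDef : ∀ v ∈ O, (G v).PosDef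

/-- The connection matrices `(A_i)^l_k = Γ^l_{ik}`. -/
noncomputable def conn (G : EuclideanSpace ℝ (Fin n) → Matrix (Fin n) (Fin n) ℝ) (i : Fin n)
    (u : EuclideanSpace ℝ (Fin n)) : Matrix (Fin n) (Fin n) ℝ :=
  Matrix.of fun l k => christoffel G l i k u

/-- The curvature matrices `∂_i A_j - ∂_j A_i + [A_i, A_j]` of the connection matrices `A`. -/
noncomputable def curv (A : Fin n → EuclideanSpace ℝ (Fin n) → Matrix (Fin n) (Fin n) ℝ)
    (i j : Fin n) (u : EuclideanSpace ℝ (Fin n)) : Matrix (Fin n) (Fin n) ℝ :=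
  mderiv i (A j) u - mderiv j (A i) u + A i u * A j u - A j u * A i u

/-- The Ricci tensor as a matrix valued function. -/
noncomputable def ricciMatrix (G : EuclideanSpace ℝ (Fin n) → Matrix (Fin n) (Fin n) ℝ)
    (u : EuclideanSpace ℝ (Fin n)) : Matrix (Fin n) (Fin n) ℝ :=
  Matrix.of fun j k => ricci G j k u

lemma conn_apply (i l k : Fin n) : conn G i u l k = christoffel G l i k u := rfl

lemma ricciMatrix_apply (j k : Fin n) : ricciMatrix G u j k = ricci G j k u := rfl

lemma curv_conn_apply (l i j k : Fin n) : curv (conn G) i j u l k = riemann G l i j k u := by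
  simp only [curv, riemann, Matrix.sub_apply, Matrix.add_apply, Matrix.mul_apply, mderiv,
    Matrix.of_apply, conn_apply, Finset.sum_sub_distrib]
  have : ∀ m, christoffel G m j k u * christoffel G l i m u =
    christoffel G l i m u * christoffel G m j k u := fun m => mul_comm _ _
  have h' : ∀ m, christoffel G m i k u * christoffel G l j m u =
    christoffel G l j m u * christoffel G m i k u := fun m => mul_comm _ _
  simp only [this, h']
  exact add_sub_assoc _ _ _

lemma ricci_eq_sum_curv (j k : Fin n) : ricci G j k u = ∑ i, curv (conn G) i j u i k := by
  simp only [curv_conn_apply, ricci]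

lemma curv_antisymm (A : Fin n → EuclideanSpace ℝ (Fin n) → Matrix (Fin n) (Fin n) ℝ)
    (i j : Fin n) : curv A i j u = -curv A j i u := by
  simp only [curv]
  abel

/-- Second derivatives cancel by symmetry, and what is left is the Leibniz rule and the Jacobi
identity for commutators. Neither a metric nor vanishing torsion enters. -/
lemma curv_bianchi {A : Fin n → EuclideanSpace ℝ (Fin n) → Matrix (Fin n) (Fin n) ℝ}
    (hO : IsOpen O) (hu : u ∈ O) (hA : ∀ i, MSmooth O (A i)) (m i j : Fin n) :
    (mderiv m (curv A i j) u + A m u * curv A i j u - curv A i j u * A m u)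
    + (mderiv i (curv A j m) u + A i u * curv A j m u - curv A j m u * A i u)
    + (mderiv j (curv A m i) u + A j u * curv A m i u - curv A m i u * A j u) = 0 := by
  have hd : ∀ i, EntryDiffAt (A i) u := fun i => (hA i).entryDiffAt hO hu
  have hdd : ∀ i j, EntryDiffAt (mderiv i (A j)) u := fun i j =>
    ((hA j).mderiv hO i).entryDiffAt hO hu
  have key : ∀ m i j, mderiv m (curv A i j) u =
      mderiv m (mderiv i (A j)) u - mderiv m (mderiv j (A i)) u
      + (mderiv m (A i) u * A j u + A i u * mderiv m (A j) u)
      - (mderiv m (A j) u * A i u + A j u * mderiv m (A i) u) := by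
    intro m i j
    unfold curv
    rw [mderiv_sub _ (((hdd i j).sub (hdd j i)).add ((hd i).mul (hd j))) ((hd j).mul (hd i)),
      mderiv_add _ ((hdd i j).sub (hdd j i)) ((hd i).mul (hd j)),
      mderiv_sub _ (hdd i j) (hdd j i), mderiv_mul _ (hd i) (hd j), mderiv_mul _ (hd j) (hd i)]
  rw [key, key, key, mderiv_comm hO hu (hA j) m i, mderiv_comm hO hu (hA i) m j,
    mderiv_comm hO hu (hA m) i j]
  simp only [curv]
  noncomm_ring

lemma curv_smooth {A : Fin n → EuclideanSpace ℝ (Fin n) → Matrix (Fin n) (Fin n) ℝ}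
    (hO : IsOpen O) (hA : ∀ i, MSmooth O (A i)) (i j : Fin n) : MSmooth O (curv A i j) :=
  ((((hA j).mderiv hO i).sub ((hA i).mderiv hO j)).add ((hA i).mul (hA j))).sub
    ((hA j).mul (hA i))

/-! ### Metric compatibility and the symmetries of the curvature. -/

namespace IsMetricOn

lemma mono {O' : Set (EuclideanSpace ℝ (Fin n))} (h : IsMetricOn O G) (hO' : IsOpen O')
    (hsub : O' ⊆ O) : IsMetricOn O' G :=
  ⟨hO', h.smooth.mono hsub, fun v hv => h.posDef v (hsub hv)⟩

lemma apply_comm (h : IsMetricOn O G) (hu : u ∈ O) (i j : Fin n) : G u i j = G u j i := by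
  simpa using (h.posDef u hu).isHermitian.apply j i

lemma transpose_eq (h : IsMetricOn O G) (hu : u ∈ O) : (G u)ᵀ = G u := by
  ext i j
  exact h.apply_comm hu j i

lemma det_ne_zero (h : IsMetricOn O G) (hu : u ∈ O) : (G u).det ≠ 0 :=
  (h.posDef u hu).det_pos.ne'

lemma mul_inv (h : IsMetricOn O G) (hu : u ∈ O) : G u * (G u)⁻¹ = 1 :=
  Matrix.mul_nonsing_inv _ (h.det_ne_zero hu).isUnit

lemma inv_mul (h : IsMetricOn O G) (hu : u ∈ O) : (G u)⁻¹ * G u = 1 :=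
  Matrix.nonsing_inv_mul _ (h.det_ne_zero hu).isUnit

lemma inv_transpose (h : IsMetricOn O G) (hu : u ∈ O) : ((G u)⁻¹)ᵀ = (G u)⁻¹ := by
  rw [Matrix.transpose_nonsing_inv, h.transpose_eq hu]

lemma inv_apply_comm (h : IsMetricOn O G) (hu : u ∈ O) (i j : Fin n) :
    (G u)⁻¹ i j = (G u)⁻¹ j i := by
  conv_lhs => rw [← h.inv_transpose hu]
  rfl

lemma smooth_inv (h : IsMetricOn O G) : MSmooth O (fun v => (G v)⁻¹) :=
  h.smooth.inv fun _ hv => h.det_ne_zero hv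

lemma smooth_conn (h : IsMetricOn O G) (i : Fin n) : MSmooth O (conn G i) := by
  intro l k
  refine contDiffOn_const.mul (ContDiffOn.sum fun m _ => (h.smooth_inv l m).mul ?_)
  exact ((contDiffOn_pderiv h.isOpen (h.smooth _ _) _).add
    (contDiffOn_pderiv h.isOpen (h.smooth _ _) _)).sub
    (contDiffOn_pderiv h.isOpen (h.smooth _ _) _)

lemma pderiv_apply_comm (h : IsMetricOn O G) (hu : u ∈ O) (i j k : Fin n) :
    pderiv k (fun v => G v i j) u = pderiv k (fun v => G v j i) u :=
  pderiv_congr k h.isOpen hu fun _ hv => h.apply_comm hv i j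

lemma christoffel_comm (h : IsMetricOn O G) (hu : u ∈ O) (k i j : Fin n) :
    christoffel G k i j u = christoffel G k j i u := by
  unfold christoffel
  congr 1
  refine Finset.sum_congr rfl fun l _ => ?_
  rw [h.pderiv_apply_comm hu i j l]
  ring

lemma sum_mul_christoffel (h : IsMetricOn O G) (hu : u ∈ O) (l i j : Fin n) :
    ∑ k, G u l k * christoffel G k i j u = (1 / 2 : ℝ) *
      (pderiv i (fun v => G v j l) u + pderiv j (fun v => G v i l) u
      - pderiv l (fun v => G v i j) u) := by
  set c : Fin n → ℝ := fun l => pderiv i (fun v => G v j l) u + pderiv j (fun v => G v i l) u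
      - pderiv l (fun v => G v i j) u with hc
  have h1 : (fun k => christoffel G k i j u) = (1 / 2 : ℝ) • ((G u)⁻¹ *ᵥ c) := by
    ext k
    simp [christoffel, Matrix.mulVec, dotProduct, hc]
  have h2 : ∑ k, G u l k * christoffel G k i j u = (G u *ᵥ fun k => christoffel G k i j u) l := rfl
  rw [h2, h1, Matrix.mulVec_smul, Matrix.mulVec_mulVec, h.mul_inv hu]
  simp [hc]

/-- This is ∇g = 0: in the sum of two lowered Christoffel symbols with `a` and `b` exchanged, all
but one derivative of the metric cancels. -/
lemma mderiv_metric (h : IsMetricOn O G) (hu : u ∈ O) (i : Fin n) :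
    mderiv i G u = G u * conn G i u + (conn G i u)ᵀ * G u := by
  ext a b
  simp only [Matrix.add_apply, Matrix.mul_apply, Matrix.transpose_apply, conn_apply, mderiv,
    Matrix.of_apply]
  have : ∀ x, christoffel G x i a u * G u x b = G u b x * christoffel G x i a u := by
    intro x
    rw [h.apply_comm hu x b, mul_comm]
  simp only [this, h.sum_mul_christoffel hu]
  rw [h.pderiv_apply_comm hu b a i]
  ring

/-- The Levi-Civita connection is the only torsion free metric connection. -/
lemma conn_unique (h : IsMetricOn O G) (hu : u ∈ O) {B : Fin n → Matrix (Fin n) (Fin n) ℝ}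
    (hsymm : ∀ i k l, B i l k = B k l i)
    (hB : ∀ i, mderiv i G u = G u * B i + (B i)ᵀ * G u) (i : Fin n) : conn G i u = B i := by
  -- Koszul's argument: with its index lowered, `B` is symmetric in its two lower indices, so
  -- permuting the metric equation determines it by the first derivatives of `G`.
  have hG : ∀ i, G u * conn G i u = G u * B i := by
    intro i
    ext l k
    have hd : ∀ i a b, pderiv i (fun v => G v a b) u = (G u * B i) a b + (G u * B i) b a := by
      intro i a b
      have := congrFun (congrFun (hB i) a) b
      simp only [Matrix.add_apply, mderiv, Matrix.of_apply] at this
      rw [this]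
      congr 1
      rw [← Matrix.transpose_apply (G u * B i), Matrix.transpose_mul, h.transpose_eq hu]
    have hs : ∀ i l k, (G u * B i) l k = (G u * B k) l i := by
      intro i l k
      simp only [Matrix.mul_apply]
      exact Finset.sum_congr rfl fun m _ => by rw [hsymm i k m]
    have := h.sum_mul_christoffel hu l i k
    rw [Matrix.mul_apply]
    simp only [conn_apply]
    rw [this, hd, hd, hd, hs k i l, hs i k l, hs k l i]
    ring
  have := congrArg (fun X => (G u)⁻¹ * X) (hG i)
  simpa [← Matrix.mul_assoc, h.inv_mul hu] using this

/-- Differentiating g⁻¹ g = 1 turns ∇g = 0 into ∇g⁻¹ = 0. -/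
lemma mderiv_inv (h : IsMetricOn O G) (hu : u ∈ O) (i : Fin n) :
    mderiv i (fun v => (G v)⁻¹) u = -(conn G i u * (G u)⁻¹ + (G u)⁻¹ * (conn G i u)ᵀ) := by
  have h1 : mderiv i (fun v => (G v)⁻¹ * G v) u = 0 := by
    rw [mderiv_congr i h.isOpen hu (Y := fun _ => 1) fun v hv => h.inv_mul hv, mderiv_const]
  rw [mderiv_mul i (h.smooth_inv.entryDiffAt h.isOpen hu) (h.smooth.entryDiffAt h.isOpen hu),
    h.mderiv_metric hu] at h1
  have h2 := congrArg (fun X => X * (G u)⁻¹) h1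
  simp only [Matrix.add_mul, Matrix.mul_add, Matrix.zero_mul, Matrix.mul_assoc, h.mul_inv hu,
    Matrix.mul_one] at h2
  rw [← Matrix.mul_assoc (G u)⁻¹ (G u), h.inv_mul hu, Matrix.one_mul] at h2
  rw [eq_neg_iff_add_eq_zero]
  exact h2

lemma curv_first_bianchi (h : IsMetricOn O G) (hu : u ∈ O) (i j k l : Fin n) :
    curv (conn G) i j u l k + curv (conn G) j k u l i + curv (conn G) k i u l j = 0 := by
  have hd : ∀ m i k, pderiv m (fun v => conn G i v l k) u = pderiv m (fun v => conn G k v l i) u :=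
    fun m i k => pderiv_congr m h.isOpen hu fun v hv => h.christoffel_comm hv l i k
  have hs : ∀ i j k, ∑ m, conn G i u l m * conn G j u m k = ∑ m, conn G i u l m * conn G k u m j :=
    fun i j k => Finset.sum_congr rfl fun m _ => by
      rw [conn_apply j, conn_apply k, h.christoffel_comm hu]
  simp only [curv, Matrix.sub_apply, Matrix.add_apply, Matrix.mul_apply, mderiv, Matrix.of_apply]
  rw [hd i j k, hd j k i, hd k i j, hs i j k, hs j k i, hs k i j]
  ring

/-- Skewness of the lowered curvature is the integrability condition of `mderiv_metric`:
differentiate it once more and commute the two derivatives. -/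
lemma metric_mul_curv (h : IsMetricOn O G) (hu : u ∈ O) (i j : Fin n) :
    G u * curv (conn G) i j u + (curv (conn G) i j u)ᵀ * G u = 0 := by
  have hA : ∀ i, EntryDiffAt (conn G i) u := fun i => (h.smooth_conn i).entryDiffAt h.isOpen hu
  have hG : EntryDiffAt G u := h.smooth.entryDiffAt h.isOpen hu
  have key : ∀ i j, mderiv i (mderiv j G) u =
      (G u * conn G i u + (conn G i u)ᵀ * G u) * conn G j u + G u * mderiv i (conn G j) u
      + ((mderiv i (conn G j) u)ᵀ * G u
        + (conn G j u)ᵀ * (G u * conn G i u + (conn G i u)ᵀ * G u)) := by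
    intro i j
    rw [mderiv_congr i h.isOpen hu (Y := fun v => G v * conn G j v + (conn G j v)ᵀ * G v)
      fun v hv => h.mderiv_metric hv j, mderiv_add i (hG.mul (hA j)) ((hA j).transpose.mul hG),
      mderiv_mul i hG (hA j), mderiv_mul i (hA j).transpose hG, mderiv_transpose,
      h.mderiv_metric hu]
  have hc := mderiv_comm h.isOpen hu h.smooth i j
  rw [key, key, ← sub_eq_zero] at hc
  rw [← hc]
  simp only [curv, Matrix.transpose_sub, Matrix.transpose_add, Matrix.transpose_mul]
  noncomm_ring

lemma curv_mul_inv_antisymm (h : IsMetricOn O G) (hu : u ∈ O) (i j : Fin n) :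
    (curv (conn G) i j u * (G u)⁻¹)ᵀ = -(curv (conn G) i j u * (G u)⁻¹) := by
  have h1 := congrArg (fun X => (G u)⁻¹ * X * (G u)⁻¹) (h.metric_mul_curv hu i j)
  simp only [Matrix.mul_add, Matrix.add_mul, Matrix.mul_zero, Matrix.zero_mul] at h1
  rw [← Matrix.mul_assoc, h.inv_mul hu, Matrix.one_mul, Matrix.mul_assoc, Matrix.mul_assoc,
    h.mul_inv hu, Matrix.mul_one] at h1
  rw [Matrix.transpose_mul, h.inv_transpose hu, eq_neg_iff_add_eq_zero, add_comm]
  exact h1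

lemma trace_curv (h : IsMetricOn O G) (hu : u ∈ O) (i j : Fin n) :
    ∑ k, curv (conn G) i j u k k = 0 := by
  have h1 : curv (conn G) i j u = -((G u)⁻¹ * (curv (conn G) i j u)ᵀ * G u) := by
    have := congrArg (fun X => (G u)⁻¹ * X) (h.metric_mul_curv hu i j)
    simp only [Matrix.mul_add, ← Matrix.mul_assoc, h.inv_mul hu, Matrix.one_mul,
      Matrix.mul_zero] at this
    exact eq_neg_iff_add_eq_zero.2 this
  have h2 := congrArg Matrix.trace h1
  rw [Matrix.trace_neg, Matrix.trace_mul_comm, ← Matrix.mul_assoc, h.mul_inv hu, Matrix.one_mul,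
    Matrix.trace_transpose] at h2
  have h3 : (curv (conn G) i j u).trace = 0 := by linarith
  simpa [Matrix.trace] using h3

/-- Trace of the first Bianchi identity: the middle term is the trace of a skew endomorphism, and
the third is minus the transposed Ricci tensor. -/
lemma ricci_comm (h : IsMetricOn O G) (hu : u ∈ O) (j k : Fin n) :
    ricci G j k u = ricci G k j u := by
  have h1 : ∑ i, (curv (conn G) i j u i k + curv (conn G) j k u i i + curv (conn G) k i u i j)
      = 0 := Finset.sum_eq_zero fun i _ => h.curv_first_bianchi hu i j k i
  have h2 : ∀ i, curv (conn G) k i u i j = -curv (conn G) i k u i j := fun i => by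
    rw [curv_antisymm, Matrix.neg_apply]
  simp only [h2, Finset.sum_add_distrib, Finset.sum_neg_distrib, h.trace_curv hu,
    ← ricci_eq_sum_curv] at h1
  linarith

lemma smooth_curv (h : IsMetricOn O G) (i j : Fin n) : MSmooth O (curv (conn G) i j) :=
  curv_smooth h.isOpen h.smooth_conn i j

lemma smooth_ricci (h : IsMetricOn O G) : MSmooth O (ricciMatrix G) := by
  intro j k
  simp only [ricciMatrix_apply, ricci_eq_sum_curv]
  exact ContDiffOn.sum fun i _ => h.smooth_curv i j i k

lemma smooth_scalar (h : IsMetricOn O G) : ContDiffOn ℝ ∞ (scalar G) O :=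
  ContDiffOn.sum fun j _ => ContDiffOn.sum fun k _ => (h.smooth_inv j k).mul (h.smooth_ricci j k)

end IsMetricOn

end Connection

/-! ### Covariant derivatives and the contracted Bianchi identity -/

section Bianchi

variable {n : ℕ} {O : Set (EuclideanSpace ℝ (Fin n))} {u : EuclideanSpace ℝ (Fin n)}
  {G : EuclideanSpace ℝ (Fin n) → Matrix (Fin n) (Fin n) ℝ}

open Matrix

/-- The covariant derivative of a tensor of type `(0,2)` in matrix form. -/
noncomputable def covMatrix (G X : EuclideanSpace ℝ (Fin n) → Matrix (Fin n) (Fin n) ℝ)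
    (k : Fin n) (u : EuclideanSpace ℝ (Fin n)) : Matrix (Fin n) (Fin n) ℝ :=
  mderiv k X u - (conn G k u)ᵀ * X u - X u * conn G k u

lemma covDeriv_eq_covMatrix (X : EuclideanSpace ℝ (Fin n) → Matrix (Fin n) (Fin n) ℝ)
    (i j k : Fin n) :
    covDeriv G (fun i j v => X v i j) i j k u = covMatrix G X k u i j := by
  simp only [covDeriv, covMatrix, Matrix.sub_apply, Matrix.mul_apply, mderiv, Matrix.of_apply,
    Matrix.transpose_apply, conn_apply, Finset.sum_add_distrib]
  have : ∀ m, christoffel G m k j u * X u i m = X u i m * christoffel G m k j u :=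
    fun m => mul_comm _ _
  simp only [this]
  ring

lemma covDeriv_ricci (i j k : Fin n) :
    covDeriv G (ricci G) i j k u = covMatrix G (ricciMatrix G) k u i j :=
  covDeriv_eq_covMatrix (ricciMatrix G) i j k

/-- The covariant derivative of the curvature tensor. -/
noncomputable def covCurv (G : EuclideanSpace ℝ (Fin n) → Matrix (Fin n) (Fin n) ℝ)
    (m i j : Fin n) (u : EuclideanSpace ℝ (Fin n)) : Matrix (Fin n) (Fin n) ℝ :=
  mderiv m (curv (conn G) i j) u + conn G m u * curv (conn G) i j u
    - curv (conn G) i j u * conn G m u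
    - ∑ p, christoffel G p m i u • curv (conn G) p j u
    - ∑ p, christoffel G p m j u • curv (conn G) i p u

namespace IsMetricOn

/-- Compared with `curv_bianchi`, the extra terms are the Christoffel corrections of the two form
indices. They cancel in the cyclic sum because Γ is symmetric and the curvature antisymmetric. -/
lemma covCurv_bianchi (h : IsMetricOn O G) (hu : u ∈ O) (m i j : Fin n) :
    covCurv G m i j u + covCurv G i j m u + covCurv G j m i u = 0 := by
  have hb := curv_bianchi h.isOpen hu h.smooth_conn m i j
  have h1 : ∀ m i j, ∑ p, christoffel G p m i u • curv (conn G) p j u =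
      -∑ p, christoffel G p i m u • curv (conn G) j p u := by
    intro m i j
    rw [← Finset.sum_neg_distrib]
    refine Finset.sum_congr rfl fun p _ => ?_
    rw [h.christoffel_comm hu, curv_antisymm _ p j, smul_neg]
  rw [← hb]
  simp only [covCurv]
  rw [h1 m i j, h1 i j m, h1 j m i]
  abel

/-- Contraction commutes with ∇: the corrections for the contracted upper and lower indices cancel
each other, which is `e2`. -/
lemma sum_covCurv (h : IsMetricOn O G) (hu : u ∈ O) (m j k : Fin n) :
    ∑ i, covCurv G m i j u i k = covMatrix G (ricciMatrix G) m u j k := by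
  have hR : ∀ j k, ricciMatrix G u j k = ∑ i, curv (conn G) i j u i k := fun j k =>
    ricci_eq_sum_curv j k
  have hd : pderiv m (fun v => ricciMatrix G v j k) u =
      ∑ i, pderiv m (fun v => curv (conn G) i j v i k) u := by
    rw [← pderiv_sum _ _ fun i _ => (h.smooth_curv i j i k).diffAt_of_isOpen h.isOpen hu]
    congr 1
    ext v
    exact ricci_eq_sum_curv j k
  simp only [covCurv, covMatrix, Matrix.sub_apply, Matrix.add_apply, Matrix.mul_apply, mderiv,
    Matrix.of_apply, Matrix.transpose_apply, hd, hR, conn_apply, Matrix.sum_apply,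
    Matrix.smul_apply, smul_eq_mul, Finset.sum_sub_distrib, Finset.sum_add_distrib]
  have e1 : ∑ i, ∑ p, curv (conn G) i j u i p * christoffel G p m k u =
      ∑ p, (∑ i, curv (conn G) i j u i p) * christoffel G p m k u := by
    rw [Finset.sum_comm]
    simp only [Finset.sum_mul]
  have e2 : ∑ i, ∑ p, christoffel G p m i u * curv (conn G) p j u i k =
      ∑ i, ∑ p, christoffel G i m p u * curv (conn G) i j u p k := by
    rw [Finset.sum_comm]
  have e3 : ∑ i, ∑ p, christoffel G p m j u * curv (conn G) i p u i k =
      ∑ p, christoffel G p m j u * ∑ i, curv (conn G) i p u i k := by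
    rw [Finset.sum_comm]
    simp only [Finset.mul_sum]
  rw [e1, e2, e3]
  ring

/-- As g⁻¹ is parallel, raising an index commutes with ∇, and the skewness of the raised curvature
passes to its covariant derivative. -/
lemma covCurv_mul_inv_antisymm (h : IsMetricOn O G) (hu : u ∈ O) (m i j : Fin n) :
    (covCurv G m i j u * (G u)⁻¹)ᵀ = -(covCurv G m i j u * (G u)⁻¹) := by
  have hs := fun i j => h.curv_mul_inv_antisymm hu i j
  have hH := h.smooth_inv.entryDiffAt h.isOpen hu
  have hC := (h.smooth_curv i j).entryDiffAt h.isOpen hu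
  have hd := mderiv_mul m hC hH
  have hd' : (mderiv m (fun v => curv (conn G) i j v * (G v)⁻¹) u)ᵀ =
      -mderiv m (fun v => curv (conn G) i j v * (G v)⁻¹) u := by
    ext a b
    simp only [mderiv, Matrix.transpose_apply, Matrix.of_apply, Matrix.neg_apply]
    have := pderiv_congr m h.isOpen hu (f := fun v => (curv (conn G) i j v * (G v)⁻¹) b a)
      (h := fun v => (-1 : ℝ) * (curv (conn G) i j v * (G v)⁻¹) a b) fun v hv => by
        have := congrFun (congrFun (h.curv_mul_inv_antisymm hv i j) a) b
        simpa using this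
    rw [this, pderiv_const_mul _ _ ((hC.mul hH) a b)]
    ring
  have key : covCurv G m i j u * (G u)⁻¹ =
      mderiv m (fun v => curv (conn G) i j v * (G v)⁻¹) u
      + conn G m u * (curv (conn G) i j u * (G u)⁻¹)
      + (curv (conn G) i j u * (G u)⁻¹) * (conn G m u)ᵀ
      - ∑ p, christoffel G p m i u • (curv (conn G) p j u * (G u)⁻¹)
      - ∑ p, christoffel G p m j u • (curv (conn G) i p u * (G u)⁻¹) := by
    rw [hd, h.mderiv_inv hu]
    simp only [covCurv, Matrix.sub_mul, Matrix.add_mul, Finset.sum_mul, Matrix.smul_mul]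
    noncomm_ring
  rw [key]
  simp only [Matrix.transpose_sub, Matrix.transpose_add, hd', Matrix.transpose_sum,
    Matrix.transpose_smul, hs, smul_neg, Finset.sum_neg_distrib,
    Matrix.transpose_mul (conn G m u), Matrix.transpose_mul (curv (conn G) i j u * (G u)⁻¹),
    Matrix.transpose_transpose]
  noncomm_ring

lemma covCurv_antisymm (h : IsMetricOn O G) (hu : u ∈ O) (m i j : Fin n) :
    covCurv G m i j u = -covCurv G m j i u := by
  have hd : mderiv m (curv (conn G) i j) u = -mderiv m (curv (conn G) j i) u := by
    ext a b
    have := pderiv_congr m h.isOpen hu (f := fun v => curv (conn G) i j v a b)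
      (h := fun v => (-1 : ℝ) * curv (conn G) j i v a b) fun v hv => by
        rw [curv_antisymm]; simp
    simp only [mderiv, Matrix.of_apply, Matrix.neg_apply]
    rw [this, pderiv_const_mul _ _ ((h.smooth_curv j i a b).diffAt_of_isOpen h.isOpen hu)]
    ring
  have h1 : ∀ p, curv (conn G) p j u = -curv (conn G) j p u := fun p => curv_antisymm _ p j
  have h2 : ∀ p, curv (conn G) i p u = -curv (conn G) p i u := fun p => curv_antisymm _ i p
  simp only [covCurv, hd, h1, h2, smul_neg, Finset.sum_neg_distrib]
  noncomm_ring

/-- The contracted second Bianchi identity. -/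
lemma contracted_bianchi (h : IsMetricOn O G) (hu : u ∈ O) (m : Fin n) :
    ∑ j, ∑ k, (G u)⁻¹ j k * covMatrix G (ricciMatrix G) m u j k =
      2 * ∑ j, ∑ k, (G u)⁻¹ j k * covMatrix G (ricciMatrix G) j u m k := by
  -- First contraction of the second Bianchi identity, over the upper index and `i`. The third term
  -- changes sign because its form indices stand in the opposite order.
  have hcyc : ∀ j k, covMatrix G (ricciMatrix G) m u j k + ∑ i, covCurv G i j m u i k
      - covMatrix G (ricciMatrix G) j u m k = 0 := by
    intro j k
    have h0 : ∑ i, (covCurv G m i j u + covCurv G i j m u + covCurv G j m i u) i k = 0 :=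
      Finset.sum_eq_zero fun i _ => by rw [h.covCurv_bianchi hu]; rfl
    have h1 : ∀ i, covCurv G j m i u i k = -covCurv G j i m u i k := fun i => by
      rw [h.covCurv_antisymm hu j m i]; rfl
    simp only [Matrix.add_apply, h1, Finset.sum_add_distrib, Finset.sum_neg_distrib,
      h.sum_covCurv hu] at h0
    linarith
  -- The second contraction, applied to the divergence of the curvature: after raising an index,
  -- skewness exchanges the two matrix indices, and the sum becomes minus the divergence of the
  -- Ricci tensor.
  have hT : ∑ j, ∑ k, (G u)⁻¹ j k * ∑ i, covCurv G i j m u i k =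
      -∑ j, ∑ k, (G u)⁻¹ j k * covMatrix G (ricciMatrix G) j u m k := by
    have h1 : ∑ j, ∑ k, (G u)⁻¹ j k * ∑ i, covCurv G i j m u i k =
        ∑ j, ∑ i, (covCurv G i j m u * (G u)⁻¹) i j := by
      refine Finset.sum_congr rfl fun j _ => ?_
      simp only [Matrix.mul_apply, Finset.mul_sum]
      rw [Finset.sum_comm]
      refine Finset.sum_congr rfl fun i _ => Finset.sum_congr rfl fun k _ => ?_
      rw [h.inv_apply_comm hu j k]
      ring
    have h2 : ∀ i j, (covCurv G i j m u * (G u)⁻¹) i j =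
        -(covCurv G i j m u * (G u)⁻¹) j i := fun i j => by
      simpa using congrFun (congrFun (h.covCurv_mul_inv_antisymm hu i j m) j) i
    rw [h1, Finset.sum_comm]
    simp only [h2, Finset.sum_neg_distrib, neg_inj]
    refine Finset.sum_congr rfl fun i _ => ?_
    simp only [← h.sum_covCurv hu, Matrix.mul_apply, Finset.mul_sum]
    rw [Finset.sum_comm]
    refine Finset.sum_congr rfl fun k _ => Finset.sum_congr rfl fun j _ => ?_
    rw [h.inv_apply_comm hu i k]
    ring
  have hs : ∑ j, ∑ k, (G u)⁻¹ j k * (covMatrix G (ricciMatrix G) m u j k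
      + ∑ i, covCurv G i j m u i k - covMatrix G (ricciMatrix G) j u m k) = 0 := by
    simp only [hcyc, mul_zero, Finset.sum_const_zero]
  simp only [mul_add, mul_sub, Finset.sum_add_distrib, Finset.sum_sub_distrib, hT] at hs
  linarith

/-- The derivative of a metric trace is the metric trace of the covariant derivative. -/
lemma pderiv_trace (h : IsMetricOn O G) (hu : u ∈ O)
    {X : EuclideanSpace ℝ (Fin n) → Matrix (Fin n) (Fin n) ℝ} (hX : EntryDiffAt X u) (m : Fin n) :
    pderiv m (fun v => ∑ j, ∑ k, (G v)⁻¹ j k * X v j k) u =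
      ∑ j, ∑ k, (G u)⁻¹ j k * covMatrix G X m u j k := by
  have hH := h.smooth_inv.entryDiffAt h.isOpen hu
  have htr : ∀ v, ∑ j, ∑ k, (G v)⁻¹ j k * X v j k = ∑ j, ((G v)⁻¹ * (X v)ᵀ) j j := fun v => rfl
  have htr' : ∑ j, ∑ k, (G u)⁻¹ j k * covMatrix G X m u j k =
    ((G u)⁻¹ * (covMatrix G X m u)ᵀ).trace := rfl
  have hl : pderiv m (fun v => ∑ j, ∑ k, (G v)⁻¹ j k * X v j k) u =
      (mderiv m (fun v => (G v)⁻¹ * (X v)ᵀ) u).trace := by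
    simp only [htr]
    rw [pderiv_sum _ _ fun j _ => (hH.mul hX.transpose) j j]
    rfl
  rw [hl, htr', mderiv_mul m hH hX.transpose, h.mderiv_inv hu, mderiv_transpose]
  simp only [covMatrix, Matrix.transpose_sub, Matrix.transpose_mul, Matrix.transpose_transpose,
    Matrix.mul_sub, Matrix.neg_mul, Matrix.add_mul, Matrix.trace_add, Matrix.trace_sub,
    Matrix.trace_neg]
  have e1 : (conn G m u * (G u)⁻¹ * (X u)ᵀ).trace = ((G u)⁻¹ * ((X u)ᵀ * conn G m u)).trace := by
    rw [Matrix.mul_assoc, Matrix.trace_mul_comm, Matrix.mul_assoc]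
  have e2 : ((G u)⁻¹ * (conn G m u)ᵀ * (X u)ᵀ).trace =
      ((G u)⁻¹ * ((conn G m u)ᵀ * (X u)ᵀ)).trace := by
    rw [Matrix.mul_assoc]
  rw [e1, e2]
  ring

lemma pderiv_scalar (h : IsMetricOn O G) (hu : u ∈ O) (m : Fin n) :
    pderiv m (scalar G) u = ∑ j, ∑ k, (G u)⁻¹ j k * covMatrix G (ricciMatrix G) m u j k :=
  h.pderiv_trace hu (h.smooth_ricci.entryDiffAt h.isOpen hu) m

end IsMetricOn

end Bianchi

/-! ### Pseudo Ricci symmetric metrics in coordinates -/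

section PseudoRicciSymmetric

variable {n : ℕ} {O : Set (EuclideanSpace ℝ (Fin n))} {u : EuclideanSpace ℝ (Fin n)}
  {G : EuclideanSpace ℝ (Fin n) → Matrix (Fin n) (Fin n) ℝ}
  {a : Fin n → EuclideanSpace ℝ (Fin n) → ℝ}

open Matrix

/-- The vector `a^i = g^{ij} a_j`. -/
noncomputable def raise (G : EuclideanSpace ℝ (Fin n) → Matrix (Fin n) (Fin n) ℝ)
    (a : Fin n → EuclideanSpace ℝ (Fin n) → ℝ) (u : EuclideanSpace ℝ (Fin n)) : Fin n → ℝ :=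
  (G u)⁻¹ *ᵥ fun i => a i u

/-- The function `g^{ij} a_i a_j`. -/
noncomputable def normSq (G : EuclideanSpace ℝ (Fin n) → Matrix (Fin n) (Fin n) ℝ)
    (a : Fin n → EuclideanSpace ℝ (Fin n) → ℝ) (u : EuclideanSpace ℝ (Fin n)) : ℝ :=
  ∑ i, ∑ j, (G u)⁻¹ i j * a i u * a j u

/-- The function `Ri_{ij} Ri^{ij}`. -/
noncomputable def ricciNormSq (G : EuclideanSpace ℝ (Fin n) → Matrix (Fin n) (Fin n) ℝ)
    (u : EuclideanSpace ℝ (Fin n)) : ℝ :=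
  ∑ j, ∑ k, (G u)⁻¹ j k * (ricciMatrix G u * (G u)⁻¹ * ricciMatrix G u) j k

/-- The metric `G` is pseudo Ricci symmetric on `O` with one form `a`. -/
structure IsPRSOn (O : Set (EuclideanSpace ℝ (Fin n)))
    (G : EuclideanSpace ℝ (Fin n) → Matrix (Fin n) (Fin n) ℝ)
    (a : Fin n → EuclideanSpace ℝ (Fin n) → ℝ) : Prop extends IsMetricOn O G where
  smooth_form : ∀ i, ContDiffOn ℝ ∞ (a i) O
  eq : ∀ v ∈ O, ∀ i j l : Fin n, covDeriv G (ricci G) i j l v =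
    2 * a l v * ricci G i j v + a i v * ricci G l j v + a j v * ricci G i l v

/-! ### Raising indices and the norm of a one form. -/

namespace IsMetricOn

lemma mulVec_raise (h : IsMetricOn O G) (hu : u ∈ O) : G u *ᵥ raise G a u = fun i => a i u := by
  rw [raise, Matrix.mulVec_mulVec, h.mul_inv hu, Matrix.one_mulVec]

lemma sum_mul_raise (h : IsMetricOn O G) (hu : u ∈ O) (i : Fin n) :
    ∑ j, G u i j * raise G a u j = a i u :=
  congrFun (h.mulVec_raise (a := a) hu) i

lemma normSq_eq (G : EuclideanSpace ℝ (Fin n) → Matrix (Fin n) (Fin n) ℝ)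
    (a : Fin n → EuclideanSpace ℝ (Fin n) → ℝ) (u : EuclideanSpace ℝ (Fin n)) :
    normSq G a u = ∑ i, a i u * raise G a u i := by
  simp only [normSq, raise, Matrix.mulVec, dotProduct, Finset.mul_sum]
  exact Finset.sum_congr rfl fun i _ => Finset.sum_congr rfl fun j _ => by ring

/-- Positive definiteness encodes the zeros of a one form in a single function, to which an equation
df = f β can apply. -/
lemma normSq_eq_zero_iff (h : IsMetricOn O G) (hu : u ∈ O) :
    normSq G a u = 0 ↔ ∀ i, a i u = 0 := by
  constructor
  · intro h0
    by_contra hne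
    have hne' : (fun i => a i u) ≠ 0 := fun h1 => hne fun i => congrFun h1 i
    have hpos := (h.posDef u hu).inv.dotProduct_mulVec_pos hne'
    rw [normSq_eq] at h0
    have : star (fun i => a i u) ⬝ᵥ (G u)⁻¹ *ᵥ (fun i => a i u) = ∑ i, a i u * raise G a u i := by
      simp [dotProduct, raise]
    rw [this, h0] at hpos
    exact lt_irrefl _ hpos
  · intro h0
    simp [normSq, h0]

lemma sum_inv_mul_left (G : EuclideanSpace ℝ (Fin n) → Matrix (Fin n) (Fin n) ℝ)
    (a : Fin n → EuclideanSpace ℝ (Fin n) → ℝ) (u : EuclideanSpace ℝ (Fin n)) (x : Fin n → ℝ) :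
    ∑ j, ∑ k, (G u)⁻¹ j k * (x j * a k u) = ∑ j, x j * raise G a u j := by
  refine Finset.sum_congr rfl fun j _ => ?_
  simp only [raise, Matrix.mulVec, dotProduct, Finset.mul_sum]
  exact Finset.sum_congr rfl fun k _ => by ring

lemma sum_inv_mul_right (h : IsMetricOn O G) (hu : u ∈ O) (x : Fin n → ℝ) :
    ∑ j, ∑ k, (G u)⁻¹ j k * (a j u * x k) = ∑ k, x k * raise G a u k := by
  rw [← sum_inv_mul_left, Finset.sum_comm]
  refine Finset.sum_congr rfl fun k _ => Finset.sum_congr rfl fun j _ => ?_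
  rw [h.inv_apply_comm hu j k]
  ring

lemma smooth_raise (h : IsMetricOn O G) (ha : ∀ i, ContDiffOn ℝ ∞ (a i) O) (i : Fin n) :
    ContDiffOn ℝ ∞ (fun v => raise G a v i) O := by
  simp only [raise, Matrix.mulVec, dotProduct]
  exact ContDiffOn.sum fun j _ => (h.smooth_inv i j).mul (ha j)

lemma smooth_normSq (h : IsMetricOn O G) (ha : ∀ i, ContDiffOn ℝ ∞ (a i) O) :
    ContDiffOn ℝ ∞ (normSq G a) O :=
  ContDiffOn.sum fun i _ => ContDiffOn.sum fun j _ => ((h.smooth_inv i j).mul (ha i)).mul (ha j)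

lemma covMatrix_metric (h : IsMetricOn O G) (hu : u ∈ O) (k : Fin n) : covMatrix G G k u = 0 := by
  rw [covMatrix, h.mderiv_metric hu]
  abel

end IsMetricOn

/-! ### First consequences of pseudo Ricci symmetry. -/

namespace IsPRSOn

lemma covMatrix_apply (h : IsPRSOn O G a) (hu : u ∈ O) (i j l : Fin n) :
    covMatrix G (ricciMatrix G) l u i j =
      2 * a l u * ricci G i j u + a i u * ricci G l j u + a j u * ricci G i l u := by
  rw [← covDeriv_ricci, h.eq u hu]

lemma pderiv_scalar_aux (h : IsPRSOn O G a) (hu : u ∈ O) (m : Fin n) :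
    pderiv m (scalar G) u =
      2 * a m u * scalar G u + 2 * ∑ k, ricci G m k u * raise G a u k := by
  rw [h.toIsMetricOn.pderiv_scalar hu]
  have : ∀ j k, (G u)⁻¹ j k * covMatrix G (ricciMatrix G) m u j k =
      2 * a m u * ((G u)⁻¹ j k * ricci G j k u) + (G u)⁻¹ j k * (a j u * ricci G m k u)
      + (G u)⁻¹ j k * (ricci G m j u * a k u) := by
    intro j k
    rw [h.covMatrix_apply hu, h.ricci_comm hu j m]
    ring
  simp only [this, Finset.sum_add_distrib, ← Finset.mul_sum]
  rw [h.sum_inv_mul_right hu, IsMetricOn.sum_inv_mul_left, scalar]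
  ring

/-- The divergence of the equation is 3 Ri(a) + sc a, so contracted Bianchi gives d sc = 6 Ri(a) + 2
sc a. The trace gives 2 Ri(a) + 2 sc a, hence Ri(a) = 0. -/
lemma sum_ricci_mul_raise (h : IsPRSOn O G a) (hu : u ∈ O) (m : Fin n) :
    ∑ k, ricci G m k u * raise G a u k = 0 := by
  have h1 := h.pderiv_scalar_aux hu m
  rw [h.toIsMetricOn.pderiv_scalar hu, h.contracted_bianchi hu] at h1
  have : ∀ j k, (G u)⁻¹ j k * covMatrix G (ricciMatrix G) j u m k =
      2 * ((G u)⁻¹ j k * (a j u * ricci G m k u)) + a m u * ((G u)⁻¹ j k * ricci G j k u)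
      + (G u)⁻¹ j k * (ricci G m j u * a k u) := by
    intro j k
    rw [h.covMatrix_apply hu]
    ring
  simp only [this, Finset.sum_add_distrib, ← Finset.mul_sum] at h1
  rw [h.sum_inv_mul_right hu, IsMetricOn.sum_inv_mul_left, scalar] at h1
  linarith

lemma pderiv_scalar (h : IsPRSOn O G a) (hu : u ∈ O) (m : Fin n) :
    pderiv m (scalar G) u = scalar G u * (2 * a m u) := by
  rw [h.pderiv_scalar_aux hu, h.sum_ricci_mul_raise hu]
  ring

lemma ricci_mulVec_raise (h : IsPRSOn O G a) (hu : u ∈ O) :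
    ricciMatrix G u *ᵥ raise G a u = 0 :=
  funext fun m => h.sum_ricci_mul_raise hu m

/-- The derivative is 2⟨Ri, ∇_m Ri⟩. The term 2 a_m Ri of ∇_m Ri contributes 4 a_m |Ri|²; the other
two terms pair Ri with `a` and vanish. -/
lemma pderiv_ricciNormSq (h : IsPRSOn O G a) (hu : u ∈ O) (m : Fin n) :
    pderiv m (ricciNormSq G) u = ricciNormSq G u * (4 * a m u) := by
  have hH := h.smooth_inv.entryDiffAt h.isOpen hu
  have hR := h.smooth_ricci.entryDiffAt h.isOpen hu
  have hsymm : (ricciMatrix G u)ᵀ = ricciMatrix G u := by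
    ext j k
    exact h.ricci_comm hu k j
  set R := ricciMatrix G u with hRdef
  set H := (G u)⁻¹ with hHdef
  set b : Fin n → ℝ := fun i => a i u with hb
  have hRw : R *ᵥ (H *ᵥ b) = 0 := h.ricci_mulVec_raise hu
  have hN : covMatrix G (ricciMatrix G) m u =
      (2 * a m u) • R + vecMulVec b (R m) + vecMulVec (R m) b := by
    ext i j
    rw [h.covMatrix_apply hu]
    simp only [Matrix.add_apply, Matrix.smul_apply, Matrix.vecMulVec_apply, smul_eq_mul, hRdef,
      ricciMatrix_apply, hb]
    rw [h.ricci_comm hu i m]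
    ring
  have hcov : covMatrix G (fun v => ricciMatrix G v * (G v)⁻¹ * ricciMatrix G v) m u =
      covMatrix G (ricciMatrix G) m u * H * R + R * H * covMatrix G (ricciMatrix G) m u := by
    simp only [covMatrix]
    rw [mderiv_mul m (hR.mul hH) hR, mderiv_mul m hR hH, h.mderiv_inv hu]
    simp only [← hRdef, ← hHdef]
    noncomm_ring
  have htr : ∀ X : Matrix (Fin n) (Fin n) ℝ, ∑ j, ∑ k, H j k * X j k = (H * X).trace := by
    intro X
    simp only [Matrix.trace, Matrix.diag, Matrix.mul_apply]
    rw [Finset.sum_comm]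
    refine Finset.sum_congr rfl fun k _ => Finset.sum_congr rfl fun j _ => ?_
    rw [hHdef, h.inv_apply_comm hu k j]
  have hq : ricciNormSq G u = (H * (R * H * R)).trace := htr _
  have hpd := h.pderiv_trace hu ((hR.mul hH).mul hR) m
  change pderiv m (ricciNormSq G) u = _ at hpd
  -- `H * R * H` is the Ricci tensor with both indices raised. It annihilates `b` on either side, so
  -- its traces against the rank one terms of `hN` are zero.
  have hKb : (H * R * H) *ᵥ b = 0 := by
    rw [Matrix.mul_assoc, ← Matrix.mulVec_mulVec, ← Matrix.mulVec_mulVec, hRw, Matrix.mulVec_zero]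
  have hbK : b ᵥ* (H * R * H) = 0 := by
    have : (H * R * H)ᵀ = H * R * H := by
      rw [Matrix.transpose_mul, Matrix.transpose_mul, hsymm, h.inv_transpose hu, Matrix.mul_assoc]
    rw [← this, Matrix.vecMul_transpose, hKb]
  have hcyc : ∀ N : Matrix (Fin n) (Fin n) ℝ,
      (H * (N * H * R + R * H * N)).trace = 2 * (H * R * H * N).trace := by
    intro N
    rw [Matrix.mul_add, Matrix.trace_add, two_mul, ← Matrix.mul_assoc H (R * H),
      ← Matrix.mul_assoc H R]
    congr 1
    rw [Matrix.mul_assoc N, Matrix.trace_mul_comm, Matrix.mul_assoc, Matrix.trace_mul_comm,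
      Matrix.mul_assoc H R, Matrix.mul_assoc H (R * H), Matrix.mul_assoc R H N,
      Matrix.trace_mul_comm H]
  rw [hpd, htr, hcov, hcyc, hq, hN, Matrix.mul_add, Matrix.mul_add, Matrix.trace_add,
    Matrix.trace_add, Matrix.mul_vecMulVec, hKb, Matrix.trace_mul_comm _ (vecMulVec (R m) b),
    Matrix.vecMulVec_mul, hbK, Matrix.mul_smul, Matrix.trace_smul]
  have : H * R * H * R = H * (R * H * R) := by noncomm_ring
  rw [this]
  simp
  ring

/-- The Cotton tensor of a pseudo Ricci symmetric metric. -/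
lemma cotton_eq (h : IsPRSOn O G a) (hn : 2 ≤ n) (hu : u ∈ O) (i j k : Fin n) :
    cotton G i j k u =
      a k u * (ricci G i j u - scalar G u / ((n : ℝ) - 1) * G u i j)
      - a j u * (ricci G i k u - scalar G u / ((n : ℝ) - 1) * G u i k) := by
  have hn' : ((n : ℝ) - 1) ≠ 0 := by
    have : (2 : ℝ) ≤ n := by exact_mod_cast hn
    linarith
  have hcov : ∀ i j k, covDeriv G (schouten G) i j k u =
      covDeriv G (ricci G) i j k u - scalar G u * (2 * a k u) / (2 * (n : ℝ) - 2) * G u i j := by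
    intro i j k
    have hs := h.smooth_scalar.diffAt_of_isOpen h.isOpen hu
    have hr := (h.smooth_ricci i j).diffAt_of_isOpen h.isOpen hu
    have hg := (h.smooth i j).diffAt_of_isOpen h.isOpen hu
    have hp : pderiv k (schouten G i j) u = pderiv k (ricci G i j) u
        - (2 * (n : ℝ) - 2)⁻¹ * (scalar G u * (2 * a k u) * G u i j
          + scalar G u * pderiv k (fun v => G v i j) u) := by
      have he : schouten G i j = fun v => ricciMatrix G v i j
          - (2 * (n : ℝ) - 2)⁻¹ * (scalar G v * G v i j) := by
        ext v
        simp only [schouten, ricciMatrix_apply]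
        ring
      rw [he, pderiv_sub _ hr ((hs.fun_mul hg).const_mul _), pderiv_const_mul _ _ (hs.fun_mul hg),
        pderiv_mul _ hs hg, h.pderiv_scalar hu]
      rfl
    -- Since ∇g = 0, the trace part of the Schouten tensor contributes only d sc = 2 sc a.
    have hG : covDeriv G (fun i j v => G v i j) i j k u = 0 := by
      rw [covDeriv_eq_covMatrix, h.covMatrix_metric hu]
      rfl
    simp only [covDeriv, Finset.sum_add_distrib] at hG ⊢
    rw [hp, sub_eq_zero.1 hG]
    simp only [schouten, mul_sub, Finset.sum_sub_distrib, mul_add, Finset.mul_sum]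
    have e : ∀ c g : ℝ, c * (scalar G u / (2 * (n : ℝ) - 2) * g) =
      (2 * (n : ℝ) - 2)⁻¹ * (scalar G u * (c * g)) := fun c g => by ring
    simp only [e]
    ring
  rw [cotton, hcov, hcov, h.eq u hu, h.eq u hu, h.ricci_comm hu k j]
  have : (2 * (n : ℝ) - 2) = 2 * ((n : ℝ) - 1) := by ring
  rw [this]
  field_simp
  ring

end IsPRSOn

end PseudoRicciSymmetric

/-! ### Covariant derivatives of one forms -/

section OneForms

variable {n : ℕ} {O : Set (EuclideanSpace ℝ (Fin n))} {u : EuclideanSpace ℝ (Fin n)}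
  {G : EuclideanSpace ℝ (Fin n) → Matrix (Fin n) (Fin n) ℝ}
  {a : Fin n → EuclideanSpace ℝ (Fin n) → ℝ}

open Matrix

/-- The component `(∇_{∂_l} a)_i` of the covariant derivative of a one form. -/
noncomputable def covForm (G : EuclideanSpace ℝ (Fin n) → Matrix (Fin n) (Fin n) ℝ)
    (a : Fin n → EuclideanSpace ℝ (Fin n) → ℝ) (l i : Fin n)
    (u : EuclideanSpace ℝ (Fin n)) : ℝ :=
  pderiv l (a i) u - ∑ m, christoffel G m l i u * a m u

namespace IsMetricOn

lemma smooth_christoffel (h : IsMetricOn O G) (k i j : Fin n) :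
    ContDiffOn ℝ ∞ (christoffel G k i j) O :=
  h.smooth_conn i k j

lemma smooth_covForm (h : IsMetricOn O G) (ha : ∀ i, ContDiffOn ℝ ∞ (a i) O) (l i : Fin n) :
    ContDiffOn ℝ ∞ (covForm G a l i) O :=
  (contDiffOn_pderiv h.isOpen (ha i) l).sub
    (ContDiffOn.sum fun m _ => (h.smooth_christoffel m l i).mul (ha m))

/-- Raising an index commutes with ∇, written with ordinary derivatives. -/
lemma pderiv_raise (h : IsMetricOn O G) (hu : u ∈ O) (ha : ∀ i, ContDiffOn ℝ ∞ (a i) O)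
    (l i : Fin n) :
    pderiv l (fun v => raise G a v i) u =
      ((G u)⁻¹ *ᵥ fun j => covForm G a l j u) i - (conn G l u *ᵥ raise G a u) i := by
  have hH := h.smooth_inv.entryDiffAt h.isOpen hu
  have hd := fun i => (ha i).diffAt_of_isOpen h.isOpen hu
  have h1 : pderiv l (fun v => raise G a v i) u =
      (mderiv l (fun v => (G v)⁻¹) u *ᵥ fun j => a j u) i
        + ((G u)⁻¹ *ᵥ fun j => pderiv l (a j) u) i := by
    simp only [raise, Matrix.mulVec, dotProduct]
    rw [pderiv_sum _ _ fun j _ => (hH i j).fun_mul (hd j), ← Finset.sum_add_distrib]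
    exact Finset.sum_congr rfl fun j _ => pderiv_mul l (hH i j) (hd j)
  have h2 : (fun j => covForm G a l j u) =
      (fun j => pderiv l (a j) u) - (conn G l u)ᵀ *ᵥ fun j => a j u := rfl
  rw [h1, h2, h.mderiv_inv hu, Matrix.mulVec_sub, Matrix.mulVec_mulVec, Matrix.neg_mulVec,
    Matrix.add_mulVec, raise, Matrix.mulVec_mulVec]
  simp only [Pi.neg_apply, Pi.add_apply, Pi.sub_apply]
  ring

lemma sum_mul_inv_mulVec (h : IsMetricOn O G) (hu : u ∈ O) (x : Fin n → ℝ) :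
    ∑ i, a i u * ((G u)⁻¹ *ᵥ x) i = ∑ i, raise G a u i * x i := by
  have : (fun i => a i u) ⬝ᵥ ((G u)⁻¹ *ᵥ x) = raise G a u ⬝ᵥ x := by
    rw [Matrix.dotProduct_mulVec, ← Matrix.mulVec_transpose, h.inv_transpose hu, raise]
  exact this

lemma pderiv_normSq (h : IsMetricOn O G) (hu : u ∈ O) (ha : ∀ i, ContDiffOn ℝ ∞ (a i) O)
    (l : Fin n) :
    pderiv l (normSq G a) u = 2 * ∑ i, raise G a u i * covForm G a l i u := by
  have hd := fun i => (ha i).diffAt_of_isOpen h.isOpen hu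
  have hw := fun i => (h.smooth_raise ha i).diffAt_of_isOpen h.isOpen hu
  have h1 : pderiv l (normSq G a) u =
      ∑ i, (pderiv l (a i) u * raise G a u i + a i u * pderiv l (fun v => raise G a v i) u) := by
    have : normSq G a = fun v => ∑ i, a i v * raise G a v i :=
      funext fun v => normSq_eq G a v
    rw [this, pderiv_sum _ _ fun i _ => (hd i).fun_mul (hw i)]
    exact Finset.sum_congr rfl fun i _ => pderiv_mul l (hd i) (hw i)
  have h2 : ∀ i, pderiv l (a i) u = covForm G a l i u + ∑ m, christoffel G m l i u * a m u :=
    fun i => by rw [covForm]; ring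
  have h3 : ∑ i, (∑ m, christoffel G m l i u * a m u) * raise G a u i =
      ∑ i, a i u * (conn G l u *ᵥ raise G a u) i := by
    simp only [Matrix.mulVec, dotProduct, Finset.mul_sum, Finset.sum_mul, conn_apply]
    rw [Finset.sum_comm]
    exact Finset.sum_congr rfl fun i _ => Finset.sum_congr rfl fun j _ => by ring
  rw [h1]
  simp only [h2, h.pderiv_raise hu ha, add_mul, mul_sub, Finset.sum_add_distrib,
    Finset.sum_sub_distrib, h.sum_mul_inv_mulVec hu, h3]
  rw [two_mul]
  have : ∑ i, covForm G a l i u * raise G a u i = ∑ i, raise G a u i * covForm G a l i u :=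
    Finset.sum_congr rfl fun i _ => mul_comm _ _
  rw [this]
  ring

lemma covForm_comm (h : IsMetricOn O G) (hu : u ∈ O)
    (hclosed : ∀ i j, pderiv i (a j) u = pderiv j (a i) u) (l i : Fin n) :
    covForm G a l i u = covForm G a i l u := by
  simp only [covForm, hclosed l i, h.christoffel_comm hu _ l i]

/-- The Ricci identity for one forms. -/
lemma ricci_identity (h : IsMetricOn O G) (hu : u ∈ O) (ha : ∀ i, ContDiffOn ℝ ∞ (a i) O)
    (k j i : Fin n) :
    covForm G (covForm G a j) k i u - covForm G (covForm G a k) j i u =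
      -∑ p, curv (conn G) k j u p i * a p u := by
  have hd := fun i => (ha i).diffAt_of_isOpen h.isOpen hu
  have hc := fun p l i => (h.smooth_christoffel p l i).diffAt_of_isOpen h.isOpen hu
  have h1 : ∀ k j, pderiv k (covForm G a j i) u = pderiv k (pderiv j (a i)) u
      - ∑ m, (pderiv k (christoffel G m j i) u * a m u
        + christoffel G m j i u * pderiv k (a m) u) := by
    intro k j
    have : covForm G a j i = fun v => pderiv j (a i) v - ∑ m, christoffel G m j i v * a m v := rfl
    rw [this, pderiv_sub _ ((contDiffOn_pderiv h.isOpen (ha i) j).diffAt_of_isOpen h.isOpen hu)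
      (DifferentiableAt.fun_sum fun m _ => (hc m j i).fun_mul (hd m)),
      pderiv_sum _ _ fun m _ => (hc m j i).fun_mul (hd m)]
    congr 1
    exact Finset.sum_congr rfl fun m _ => pderiv_mul k (hc m j i) (hd m)
  -- Here `j` is a mere label of the inner one form, so the correction Γ^m_{kj} ∇_m a_i of the true
  -- second covariant derivative is absent. It is symmetric in `k` and `j` and would drop out of the
  -- difference.
  have h2 : ∀ k j, covForm G (covForm G a j) k i u = pderiv k (pderiv j (a i)) u
      - ∑ m, pderiv k (christoffel G m j i) u * a m u
      - ∑ m, christoffel G m j i u * pderiv k (a m) u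
      - ∑ m, christoffel G m k i u * pderiv j (a m) u
      + ∑ p, (∑ m, christoffel G p j m u * christoffel G m k i u) * a p u := by
    intro k j
    have e : ∑ p, (∑ m, christoffel G p j m u * christoffel G m k i u) * a p u =
        ∑ m, christoffel G m k i u * ∑ p, christoffel G p j m u * a p u := by
      simp only [Finset.mul_sum, Finset.sum_mul]
      rw [Finset.sum_comm]
      exact Finset.sum_congr rfl fun m _ => Finset.sum_congr rfl fun p _ => by ring
    rw [e]
    conv_lhs => rw [covForm, h1]
    simp only [covForm, mul_sub, Finset.sum_sub_distrib, Finset.sum_add_distrib]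
    ring
  have h3 : ∑ p, curv (conn G) k j u p i * a p u =
      ∑ m, pderiv k (christoffel G m j i) u * a m u
      - ∑ m, pderiv j (christoffel G m k i) u * a m u
      + ∑ p, (∑ m, christoffel G p k m u * christoffel G m j i u) * a p u
      - ∑ p, (∑ m, christoffel G p j m u * christoffel G m k i u) * a p u := by
    rw [← Finset.sum_sub_distrib, ← Finset.sum_add_distrib, ← Finset.sum_sub_distrib]
    refine Finset.sum_congr rfl fun p _ => ?_
    simp only [curv, Matrix.sub_apply, Matrix.add_apply, Matrix.mul_apply, conn_apply]
    have : ∀ k j, mderiv k (conn G j) u p i = pderiv k (christoffel G p j i) u := fun _ _ => rfl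
    rw [this, this]
    ring
  rw [h2, h2, h3, pderiv_comm h.isOpen hu (ha i) k j]
  ring

lemma sum_inv_mul_metric (h : IsMetricOn O G) (hu : u ∈ O) (k j : Fin n) :
    ∑ i, (G u)⁻¹ k i * G u j i = if k = j then 1 else 0 := by
  have : ∀ i, (G u)⁻¹ k i * G u j i = (G u)⁻¹ k i * G u i j := fun i => by
    rw [h.apply_comm hu j i]
  simp only [this]
  rw [← Matrix.mul_apply, h.inv_mul hu, Matrix.one_apply]

/-- The contraction of the curvature with a null vector of the Ricci tensor. -/
lemma sum_curv_raise_eq_zero (h : IsMetricOn O G) (hu : u ∈ O)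
    (hnull : ∀ m, ∑ k, ricci G m k u * raise G a u k = 0) (j : Fin n) :
    ∑ k, ∑ i, (G u)⁻¹ k i * ∑ p, curv (conn G) k j u p i * a p u = 0 := by
  have h1 : ∀ k, ∑ i, (G u)⁻¹ k i * ∑ p, curv (conn G) k j u p i * a p u =
      -∑ i, curv (conn G) k j u k i * raise G a u i := by
    intro k
    have e1 : ∑ i, (G u)⁻¹ k i * ∑ p, curv (conn G) k j u p i * a p u =
        ∑ p, (curv (conn G) k j u * (G u)⁻¹) p k * a p u := by
      simp only [Matrix.mul_apply, Finset.mul_sum, Finset.sum_mul]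
      rw [Finset.sum_comm]
      refine Finset.sum_congr rfl fun p _ => Finset.sum_congr rfl fun i _ => ?_
      rw [h.inv_apply_comm hu k i]
      ring
    -- Skewness moves `a` from the upper to the lower slot of the curvature; the sum over `k` is
    -- then a Ricci contraction.
    have e2 : ∀ p, (curv (conn G) k j u * (G u)⁻¹) p k = -(curv (conn G) k j u * (G u)⁻¹) k p :=
      fun p => by simpa using congrFun (congrFun (h.curv_mul_inv_antisymm hu k j) k) p
    have e3 : ∑ p, (curv (conn G) k j u * (G u)⁻¹) k p * a p u =
        ((curv (conn G) k j u * (G u)⁻¹) *ᵥ fun p => a p u) k := rfl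
    rw [e1]
    simp only [e2, neg_mul, Finset.sum_neg_distrib]
    rw [e3, ← Matrix.mulVec_mulVec]
    rfl
  simp only [h1, Finset.sum_neg_distrib]
  rw [Finset.sum_comm, ← neg_zero, ← hnull j]
  congr 1
  refine Finset.sum_congr rfl fun i _ => ?_
  rw [ricci_eq_sum_curv, Finset.sum_mul]

/-- If `∇a = e a ⊗ a - |a|² g` and `a` is a null vector of the Ricci tensor, then `e = 2`. -/
lemma eq_two_of_covForm_eq (h : IsMetricOn O G) (hn : 2 ≤ n)
    (ha : ∀ i, ContDiffOn ℝ ∞ (a i) O) {e : EuclideanSpace ℝ (Fin n) → ℝ}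
    (he : ContDiffOn ℝ ∞ e O)
    (hcov : ∀ v ∈ O, ∀ l i, covForm G a l i v = -normSq G a v * G v l i + e v * a l v * a i v)
    (hu : u ∈ O) (hnull : ∀ m, ∑ k, ricci G m k u * raise G a u k = 0)
    (hF : normSq G a u ≠ 0) : e u = 2 := by
  have hd := fun i => (ha i).diffAt_of_isOpen h.isOpen hu
  have hFd := (h.smooth_normSq ha).diffAt_of_isOpen h.isOpen hu
  have hed := he.diffAt_of_isOpen h.isOpen hu
  have hGd := h.smooth.entryDiffAt h.isOpen hu
  set F := normSq G a with hFdef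
  set w := raise G a u with hw
  have hFw : F u = ∑ i, a i u * w i := normSq_eq G a u
  have hGw : ∀ l, ∑ i, w i * G u l i = a l u := fun l => by
    rw [← h.sum_mul_raise (a := a) hu l]
    exact Finset.sum_congr rfl fun i _ => mul_comm _ _
  -- d|a|² = 2 ∇a(·, w), where the metric term contributes -F and the rank one term e F.
  have hF' : ∀ l, pderiv l F u = 2 * (e u - 1) * F u * a l u := by
    intro l
    rw [hFdef, h.pderiv_normSq hu ha, ← hw]
    have : ∀ i, w i * covForm G a l i u =
        -F u * (w i * G u l i) + e u * a l u * (a i u * w i) := fun i => by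
      rw [hcov u hu]; ring
    simp only [this, Finset.sum_add_distrib, ← Finset.mul_sum, hGw, ← hFw]
    ring
  have hsymm : ∀ k j, pderiv k (a j) u = pderiv j (a k) u := by
    intro k j
    have h1 := hcov u hu k j
    have h2 := hcov u hu j k
    simp only [covForm, h.christoffel_comm hu _ k j, h.apply_comm hu k j] at h1 h2
    linarith
  have hG' : ∀ k j i, pderiv k (fun v => G v j i) u =
      ∑ m, G u j m * christoffel G m k i u + ∑ m, G u i m * christoffel G m k j u := by
    intro k j i
    have := congrFun (congrFun (h.mderiv_metric hu k) j) i
    simp only [mderiv, Matrix.of_apply, Matrix.add_apply, Matrix.mul_apply, Matrix.transpose_apply,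
      conn_apply] at this
    rw [this]
    congr 1
    exact Finset.sum_congr rfl fun m _ => by rw [h.apply_comm hu i m, mul_comm]
  have hsecond : ∀ k j i, covForm G (covForm G a j) k i u =
      -(2 * (e u - 1) * F u * a k u) * G u j i - F u * ∑ m, G u i m * christoffel G m k j u
      + pderiv k e u * a j u * a i u + e u * pderiv k (a j) u * a i u
      + e u * a j u * covForm G a k i u := by
    intro k j i
    have h1 : pderiv k (covForm G a j i) u =
        -(2 * (e u - 1) * F u * a k u) * G u j i - F u * pderiv k (fun v => G v j i) u
        + (pderiv k e u * a j u + e u * pderiv k (a j) u) * a i u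
        + e u * a j u * pderiv k (a i) u := by
      have hc : pderiv k (covForm G a j i) u =
          pderiv k (fun v => e v * a j v * a i v - F v * G v j i) u :=
        pderiv_congr k h.isOpen hu fun v hv => by rw [hcov v hv]; ring
      rw [hc, pderiv_sub _ ((hed.fun_mul (hd j)).fun_mul (hd i)) (hFd.fun_mul (hGd j i)),
        pderiv_mul _ (hed.fun_mul (hd j)) (hd i), pderiv_mul _ hed (hd j),
        pderiv_mul _ hFd (hGd j i), hF']
      ring
    have h2 : ∑ m, christoffel G m k i u * covForm G a j m u =
        -F u * ∑ m, G u j m * christoffel G m k i u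
        + e u * a j u * ∑ m, christoffel G m k i u * a m u := by
      simp only [Finset.mul_sum]
      rw [← Finset.sum_add_distrib]
      exact Finset.sum_congr rfl fun m _ => by rw [hcov u hu]; ring
    conv_lhs => rw [covForm, h1, h2, hG']
    conv_rhs => rw [covForm]
    ring
  -- The Ricci identity with the assumed form of ∇a inserted; everything symmetric in `k` and `j`
  -- has cancelled.
  have hid : ∀ k j i, (e u - 2) * F u * (a j u * G u k i - a k u * G u j i)
      + (pderiv k e u * a j u - pderiv j e u * a k u) * a i u
      = -∑ p, curv (conn G) k j u p i * a p u := by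
    intro k j i
    have := h.ricci_identity hu ha k j i
    rw [hsecond, hsecond, hcov u hu, hcov u hu, hsymm k j] at this
    simp only [h.christoffel_comm hu _ k j] at this
    rw [← this]
    ring
  have hi : ∀ k j, (e u - 2) * F u * (a j u - a k u * if k = j then 1 else 0)
      + (pderiv k e u * a j u - pderiv j e u * a k u) * w k
      = -∑ i, (G u)⁻¹ k i * ∑ p, curv (conn G) k j u p i * a p u := by
    intro k j
    have e0 : ∀ i, (G u)⁻¹ k i * ∑ p, curv (conn G) k j u p i * a p u =
        -((e u - 2) * F u * a j u * ((G u)⁻¹ k i * G u k i)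
          - (e u - 2) * F u * a k u * ((G u)⁻¹ k i * G u j i)
          + (pderiv k e u * a j u - pderiv j e u * a k u) * ((G u)⁻¹ k i * a i u)) := by
      intro i
      rw [← neg_neg (∑ p, curv (conn G) k j u p i * a p u), ← hid k j i]
      ring
    simp only [e0, Finset.sum_neg_distrib, Finset.sum_add_distrib, Finset.sum_sub_distrib,
      ← Finset.mul_sum, h.sum_inv_mul_metric hu]
    have : ∑ i, (G u)⁻¹ k i * a i u = w k := rfl
    rw [this]
    simp only [if_true]
    ring
  -- Summing over `k` completes the contraction with g^{ki}. The curvature side vanishes because `a`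
  -- is a null vector of Ri, and the Kronecker delta turns the factor n into n - 1.
  have hj : ∀ j, (e u - 2) * F u * (n * a j u - a j u)
      + ((∑ k, pderiv k e u * w k) * a j u - pderiv j e u * F u) = 0 := by
    intro j
    have h0 := h.sum_curv_raise_eq_zero hu hnull j
    have h1 : ∑ k, ((e u - 2) * F u * (a j u - a k u * if k = j then 1 else 0)
      + (pderiv k e u * a j u - pderiv j e u * a k u) * w k) = 0 := by
      simp only [hi, Finset.sum_neg_distrib, h0, neg_zero]
    have h2 : ∀ k, (pderiv k e u * a j u - pderiv j e u * a k u) * w k =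
        pderiv k e u * w k * a j u - pderiv j e u * (a k u * w k) := fun k => by ring
    simp only [h2, Finset.sum_add_distrib, Finset.sum_sub_distrib, ← Finset.mul_sum,
      ← Finset.sum_mul, ← hFw] at h1
    rw [← h1]
    simp
  -- Contraction with `w` makes the two terms containing de opposite, so nothing about de has to be
  -- known.
  have hfin : (e u - 2) * F u ^ 2 * (n - 1) = 0 := by
    have h0 : ∑ j, ((e u - 2) * F u * (n * a j u - a j u)
      + ((∑ k, pderiv k e u * w k) * a j u - pderiv j e u * F u)) * w j = 0 := by
      simp [hj]
    have h1 : ∀ j, ((e u - 2) * F u * (n * a j u - a j u)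
      + ((∑ k, pderiv k e u * w k) * a j u - pderiv j e u * F u)) * w j =
        (e u - 2) * F u * (n - 1) * (a j u * w j) + (∑ k, pderiv k e u * w k) * (a j u * w j)
          - F u * (pderiv j e u * w j) := fun j => by ring
    simp only [h1, Finset.sum_add_distrib, Finset.sum_sub_distrib, ← Finset.mul_sum, ← hFw] at h0
    rw [← h0]
    ring
  have hn' : ((n : ℝ) - 1) ≠ 0 := by
    have : (2 : ℝ) ≤ n := by exact_mod_cast hn
    linarith
  have := (mul_eq_zero.1 hfin).resolve_right hn'
  have := (mul_eq_zero.1 this).resolve_right (pow_ne_zero 2 hF)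
  linarith

end IsMetricOn

end OneForms

/-! ### Cotton flat pseudo Ricci symmetric metrics in coordinates -/

section CottonFlat

variable {n : ℕ} {O : Set (EuclideanSpace ℝ (Fin n))} {u : EuclideanSpace ℝ (Fin n)}
  {G : EuclideanSpace ℝ (Fin n) → Matrix (Fin n) (Fin n) ℝ}
  {a : Fin n → EuclideanSpace ℝ (Fin n) → ℝ}

open Matrix

namespace IsPRSOn

/-- Locally 2a = d log |sc|. Equality of the mixed second derivatives of sc expresses this without
the logarithm. -/
lemma closed (h : IsPRSOn O G a) (hu : u ∈ O) (hsc : scalar G u ≠ 0) (i j : Fin n) :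
    pderiv i (a j) u = pderiv j (a i) u := by
  have hs := h.smooth_scalar.diffAt_of_isOpen h.isOpen hu
  have hd := fun i => (h.smooth_form i).diffAt_of_isOpen h.isOpen hu
  have key : ∀ i j, pderiv i (pderiv j (scalar G)) u =
      scalar G u * (2 * a i u) * (2 * a j u) + scalar G u * (2 * pderiv i (a j) u) := by
    intro i j
    rw [pderiv_congr i h.isOpen hu (h := fun v => scalar G v * (2 * a j v))
      fun v hv => h.pderiv_scalar hv j, pderiv_mul _ hs ((hd j).const_mul 2), h.pderiv_scalar hu,
      pderiv_const_mul _ _ (hd j)]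
  have hc := pderiv_comm h.isOpen hu h.smooth_scalar i j
  rw [key, key] at hc
  have : scalar G u * (pderiv i (a j) u - pderiv j (a i) u) = 0 := by linarith
  have := (mul_eq_zero.1 this).resolve_left hsc
  linarith

/-- The Ricci tensor of a Cotton flat pseudo Ricci symmetric metric. -/
lemma normSq_mul_ricci (h : IsPRSOn O G a) (hn : 2 ≤ n) (hu : u ∈ O)
    (hC : ∀ i j k, cotton G i j k u = 0) (i j : Fin n) :
    normSq G a u * ricci G i j u =
      scalar G u / ((n : ℝ) - 1) * (normSq G a u * G u i j - a i u * a j u) := by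
  set ρ := scalar G u / ((n : ℝ) - 1) with hρ
  -- C_ijk = 0 multiplied by a^k, before summing over `k`. In the sum Ri(a) = 0 removes one term and
  -- |a|² appears.
  have h1 : ∀ k, a k u * raise G a u k * (ricci G i j u - ρ * G u i j) =
      a j u * (ricci G i k u * raise G a u k - ρ * (G u i k * raise G a u k)) := by
    intro k
    have := h.cotton_eq hn hu i j k
    rw [hC] at this
    linear_combination (-raise G a u k) * this
  have h2 := Finset.sum_congr (rfl : (Finset.univ : Finset (Fin n)) = _) fun k _ => h1 k
  rw [← Finset.sum_mul, ← IsMetricOn.normSq_eq, ← Finset.mul_sum, Finset.sum_sub_distrib,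
    ← Finset.mul_sum, h.sum_ricci_mul_raise hu, h.sum_mul_raise hu] at h2
  linarith

/-- The derivative of `Ri(a, ·) = 0`. -/
lemma normSq_mul_ricci_add (h : IsPRSOn O G a) (hu : u ∈ O) (i l : Fin n) :
    normSq G a u * ricci G i l u
      + (ricciMatrix G u *ᵥ (G u)⁻¹ *ᵥ fun j => covForm G a l j u) i = 0 := by
  have hR := h.smooth_ricci.entryDiffAt h.isOpen hu
  have hw := fun i => (h.smooth_raise h.smooth_form i).diffAt_of_isOpen h.isOpen hu
  have h1 : ((mderiv l (ricciMatrix G) u *ᵥ raise G a u)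
      + ricciMatrix G u *ᵥ fun j => pderiv l (fun v => raise G a v j) u) i = 0 := by
    have hz : pderiv l (fun v => ∑ j, ricciMatrix G v i j * raise G a v j) u = 0 := by
      rw [pderiv_congr l h.isOpen hu (f := fun v => ∑ j, ricciMatrix G v i j * raise G a v j)
        (h := fun _ => 0) fun v hv => h.sum_ricci_mul_raise hv i, pderiv_const]
    rw [pderiv_sum _ _ fun j _ => (hR i j).fun_mul (hw j)] at hz
    rw [← hz]
    simp only [Pi.add_apply, Matrix.mulVec, dotProduct]
    rw [← Finset.sum_add_distrib]
    exact Finset.sum_congr rfl fun j _ => (pderiv_mul l (hR i j) (hw j)).symm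
  have h2 : (fun j => pderiv l (fun v => raise G a v j) u) =
      (G u)⁻¹ *ᵥ (fun j => covForm G a l j u) - conn G l u *ᵥ raise G a u :=
    funext fun j => h.pderiv_raise hu h.smooth_form l j
  have h3 : mderiv l (ricciMatrix G) u = covMatrix G (ricciMatrix G) l u
      + (conn G l u)ᵀ * ricciMatrix G u + ricciMatrix G u * conn G l u := by
    simp only [covMatrix]
    abel
  -- Two of the three terms of ∇_l Ri, applied to the raised `a`, contain Ri(a) = 0.
  have h4 : (covMatrix G (ricciMatrix G) l u *ᵥ raise G a u) i =
      normSq G a u * ricci G i l u := by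
    simp only [Matrix.mulVec, dotProduct]
    have : ∀ j, covMatrix G (ricciMatrix G) l u i j * raise G a u j =
        2 * a l u * (ricci G i j u * raise G a u j) + a i u * (ricci G l j u * raise G a u j)
        + ricci G i l u * (a j u * raise G a u j) := fun j => by
      rw [h.covMatrix_apply hu]; ring
    simp only [this, Finset.sum_add_distrib, ← Finset.mul_sum, h.sum_ricci_mul_raise hu,
      ← IsMetricOn.normSq_eq]
    ring
  rw [h2, h3, Matrix.add_mulVec, Matrix.add_mulVec, ← Matrix.mulVec_mulVec, ← Matrix.mulVec_mulVec,
    h.ricci_mulVec_raise hu, Matrix.mulVec_zero, Matrix.mulVec_sub] at h1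
  simp only [Pi.add_apply, Pi.sub_apply, h4, Pi.zero_apply] at h1
  linarith

/-- The covariant derivative of the one form of a Cotton flat pseudo Ricci symmetric metric. -/
lemma normSq_sq_mul_covForm (h : IsPRSOn O G a) (hn : 2 ≤ n) (hu : u ∈ O) (hsc : scalar G u ≠ 0)
    (hC : ∀ i j k, cotton G i j k u = 0) (l i : Fin n) :
    normSq G a u ^ 2 * covForm G a l i u =
      -normSq G a u ^ 2 * (normSq G a u * G u l i - a l u * a i u)
      + (∑ j, raise G a u j * ∑ k, raise G a u k * covForm G a j k u) * a l u * a i u := by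
  have hn' : ((n : ℝ) - 1) ≠ 0 := by
    have : (2 : ℝ) ≤ n := by exact_mod_cast hn
    linarith
  set F := normSq G a u with hF
  set ρ := scalar G u / ((n : ℝ) - 1) with hρ
  have hρ0 : ρ ≠ 0 := div_ne_zero hsc hn'
  set w := raise G a u with hw
  set β : Fin n → ℝ := fun l => ∑ k, w k * covForm G a l k u with hβ
  have hstar := h.normSq_mul_ricci hn hu hC
  -- The derivative of Ri(a) = 0, with Ri replaced by its Cotton flat form. That form is ρ times a
  -- projection along `a`, so ρ ≠ 0 cancels and ∇a is known up to `a i u * β l`.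
  have h1 : ∀ l i, F * covForm G a l i u = -F * (F * G u l i - a l u * a i u) + a i u * β l := by
    intro l i
    set y : Fin n → ℝ := (G u)⁻¹ *ᵥ fun j => covForm G a l j u with hy
    have hGy : ∑ j, G u i j * y j = covForm G a l i u := by
      have : G u *ᵥ y = fun j => covForm G a l j u := by
        rw [hy, Matrix.mulVec_mulVec, h.mul_inv hu, Matrix.one_mulVec]
      exact congrFun this i
    have hay : ∑ j, a j u * y j = β l := h.sum_mul_inv_mulVec hu _
    have hRy : F * (ricciMatrix G u *ᵥ y) i = ρ * (F * covForm G a l i u - a i u * β l) := by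
      simp only [Matrix.mulVec, dotProduct, Finset.mul_sum]
      have : ∀ j, F * (ricciMatrix G u i j * y j) =
          ρ * F * (G u i j * y j) - ρ * a i u * (a j u * y j) := fun j => by
        rw [← mul_assoc, ricciMatrix_apply, hstar]; ring
      simp only [this, Finset.sum_sub_distrib, ← Finset.mul_sum, hGy, hay]
      ring
    have h2 := h.normSq_mul_ricci_add hu i l
    have h3 : F * (F * ricci G i l u) + F * (ricciMatrix G u *ᵥ y) i = 0 := by
      rw [← mul_add, h2, mul_zero]
    rw [hRy, hstar, h.apply_comm hu i l] at h3
    have h4 : ρ * (F * (F * G u l i - a l u * a i u) + (F * covForm G a l i u - a i u * β l)) = 0 :=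
      by linear_combination h3
    linear_combination (mul_eq_zero.1 h4).resolve_left hρ0
  have hFw : F = ∑ i, a i u * w i := IsMetricOn.normSq_eq G a u
  have h2 : F * β l = a l u * ∑ j, w j * β j := by
    -- As `a` is closed, ∇a is symmetric; comparing `h1` with its transpose shows that `β` is
    -- parallel to `a`.
    have h3 : ∀ i, a i u * β l = a l u * β i := by
      intro i
      have e1 := h1 l i
      have e2 := h1 i l
      rw [h.covForm_comm hu (fun i j => h.closed hu hsc i j) l i, h.apply_comm hu l i] at e1
      linear_combination e2 - e1
    rw [hFw, Finset.sum_mul, Finset.mul_sum]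
    exact Finset.sum_congr rfl fun i _ => by linear_combination w i * h3 i
  linear_combination F * h1 l i + a i u * h2

/-- On a Cotton flat pseudo Ricci symmetric metric `d|a|² = 2 |a|² a`. -/
lemma pderiv_normSq_eq (h : IsPRSOn O G a) (hn : 2 ≤ n) (hsc : ∀ v ∈ O, scalar G v ≠ 0)
    (hC : ∀ v ∈ O, ∀ i j k, cotton G i j k v = 0) (hu : u ∈ O) (l : Fin n) :
    pderiv l (normSq G a) u = normSq G a u * (2 * a l u) := by
  rw [h.toIsMetricOn.pderiv_normSq hu h.smooth_form]
  by_cases hF : normSq G a u = 0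
  · have hz := (h.normSq_eq_zero_iff hu).1 hF
    have hr : raise G a u = 0 := by
      have : (fun i => a i u) = 0 := funext hz
      rw [raise, this, Matrix.mulVec_zero]
    simp [hF, hr]
  set κ : EuclideanSpace ℝ (Fin n) → ℝ :=
    fun v => ∑ j, raise G a v j * ∑ k, raise G a v k * covForm G a j k v with hκ
  have hκs : ContDiffOn ℝ ∞ κ O := ContDiffOn.sum fun j _ =>
    (h.smooth_raise h.smooth_form j).mul (ContDiffOn.sum fun k _ =>
      (h.smooth_raise h.smooth_form k).mul (h.smooth_covForm h.smooth_form j k))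
  have hFs := h.smooth_normSq h.smooth_form
  -- Where |a|² ≠ 0 one may divide by its square, which gives the smooth coefficient e = 1 + κ/|a|⁴.
  set O' : Set (EuclideanSpace ℝ (Fin n)) := O ∩ normSq G a ⁻¹' {0}ᶜ with hO'
  have hO'o : IsOpen O' := hFs.continuousOn.isOpen_inter_preimage h.isOpen isOpen_compl_singleton
  have hu' : u ∈ O' := ⟨hu, hF⟩
  have hm : IsMetricOn O' G := h.mono hO'o Set.inter_subset_left
  have he : ContDiffOn ℝ ∞ (fun v => 1 + κ v / normSq G a v ^ 2) O' :=
    contDiffOn_const.add ((hκs.mono Set.inter_subset_left).div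
      ((hFs.mono Set.inter_subset_left).pow 2) fun v hv => pow_ne_zero 2 hv.2)
  have hcov : ∀ v ∈ O', ∀ l i, covForm G a l i v =
      -normSq G a v * G v l i + (1 + κ v / normSq G a v ^ 2) * a l v * a i v := by
    intro v hv l i
    have hFv : normSq G a v ≠ 0 := hv.2
    have := h.normSq_sq_mul_covForm hn hv.1 (hsc v hv.1) (hC v hv.1) l i
    apply mul_left_cancel₀ (pow_ne_zero 2 hFv)
    rw [this]
    field_simp
    ring
  have h2 := hm.eq_two_of_covForm_eq hn (fun i => (h.smooth_form i).mono Set.inter_subset_left) he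
    hcov hu' (h.sum_ricci_mul_raise hu) hF
  have h3 : ∀ i, raise G a u i * covForm G a l i u =
      -normSq G a u * (G u l i * raise G a u i) + 2 * a l u * (a i u * raise G a u i) := by
    intro i
    rw [hcov u hu', h2]
    ring
  simp only [h3, Finset.sum_add_distrib, ← Finset.mul_sum, h.sum_mul_raise hu,
    ← IsMetricOn.normSq_eq]
  ring

end IsPRSOn

end CottonFlat

/-! ### Quasi Einstein metrics in coordinates -/

section QuasiEinstein

variable {n : ℕ} {O : Set (EuclideanSpace ℝ (Fin n))} {u : EuclideanSpace ℝ (Fin n)}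
  {G : EuclideanSpace ℝ (Fin n) → Matrix (Fin n) (Fin n) ℝ}
  {a η : Fin n → EuclideanSpace ℝ (Fin n) → ℝ} {A B : ℝ}

open Matrix

/-! ### Traces of a quasi Einstein Ricci tensor. -/

namespace IsMetricOn

/-- As an endomorphism Ri is a multiple of the identity plus a rank one term, so the traces of it
and of its square can be read off. -/
lemma inv_mul_ricci_of_quasiEinstein (h : IsMetricOn O G) (hu : u ∈ O)
    (hR : ∀ i j, ricci G i j u = A * G u i j + B * (η i u * η j u / normSq G η u)) :
    (G u)⁻¹ * ricciMatrix G u =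
      A • 1 + (B / normSq G η u) • vecMulVec (raise G η u) (fun i => η i u) := by
  have : ricciMatrix G u =
      A • G u + (B / normSq G η u) • vecMulVec (fun i => η i u) (fun i => η i u) := by
    ext i j
    simp only [ricciMatrix_apply, hR, Matrix.add_apply, Matrix.smul_apply, Matrix.vecMulVec_apply,
      smul_eq_mul]
    ring
  rw [this, Matrix.mul_add, Matrix.mul_smul, Matrix.mul_smul, h.inv_mul hu, Matrix.mul_vecMulVec]
  rfl

lemma scalar_eq_trace (h : IsMetricOn O G) (hu : u ∈ O) :
    scalar G u = ((G u)⁻¹ * ricciMatrix G u).trace := by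
  simp only [scalar, Matrix.trace, Matrix.diag, Matrix.mul_apply, ricciMatrix_apply]
  exact Finset.sum_congr rfl fun j _ => Finset.sum_congr rfl fun k _ => by
    rw [h.ricci_comm hu j k]

lemma ricciNormSq_eq_trace (h : IsMetricOn O G) (hu : u ∈ O) :
    ricciNormSq G u = ((G u)⁻¹ * ricciMatrix G u * ((G u)⁻¹ * ricciMatrix G u)).trace := by
  have : (G u)⁻¹ * ricciMatrix G u * ((G u)⁻¹ * ricciMatrix G u) =
      (G u)⁻¹ * (ricciMatrix G u * (G u)⁻¹ * ricciMatrix G u) := by noncomm_ring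
  rw [this]
  simp only [ricciNormSq, Matrix.trace, Matrix.diag]
  rw [Finset.sum_comm]
  refine Finset.sum_congr rfl fun k _ => ?_
  rw [Matrix.mul_apply (M := (G u)⁻¹)]
  exact Finset.sum_congr rfl fun j _ => by rw [h.inv_apply_comm hu j k]

lemma raise_dotProduct_self (G : EuclideanSpace ℝ (Fin n) → Matrix (Fin n) (Fin n) ℝ)
    (η : Fin n → EuclideanSpace ℝ (Fin n) → ℝ) (u : EuclideanSpace ℝ (Fin n)) :
    raise G η u ⬝ᵥ (fun i => η i u) = normSq G η u := by
  rw [normSq_eq, dotProduct_comm]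
  rfl

lemma scalar_of_quasiEinstein (h : IsMetricOn O G) (hu : u ∈ O) (hη : normSq G η u ≠ 0)
    (hR : ∀ i j, ricci G i j u = A * G u i j + B * (η i u * η j u / normSq G η u)) :
    scalar G u = n * A + B := by
  rw [h.scalar_eq_trace hu, h.inv_mul_ricci_of_quasiEinstein hu hR, Matrix.trace_add,
    Matrix.trace_smul, Matrix.trace_smul, Matrix.trace_vecMulVec, raise_dotProduct_self]
  simp only [Matrix.trace_one, Fintype.card_fin, smul_eq_mul]
  field_simp

lemma ricciNormSq_of_quasiEinstein (h : IsMetricOn O G) (hu : u ∈ O) (hη : normSq G η u ≠ 0)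
    (hR : ∀ i j, ricci G i j u = A * G u i j + B * (η i u * η j u / normSq G η u)) :
    ricciNormSq G u = n * A ^ 2 + 2 * A * B + B ^ 2 := by
  rw [h.ricciNormSq_eq_trace hu, h.inv_mul_ricci_of_quasiEinstein hu hR]
  simp only [Matrix.mul_add, Matrix.add_mul, Matrix.smul_mul, Matrix.mul_smul, Matrix.one_mul,
    Matrix.mul_one, Matrix.vecMulVec_mul_vecMulVec, Matrix.trace_add, Matrix.trace_smul,
    Matrix.trace_vecMulVec, raise_dotProduct_self, Matrix.trace_one, Fintype.card_fin, smul_eq_mul,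
    dotProduct_comm (fun i => η i u) (raise G η u), dotProduct_smul]
  field_simp
  ring

end IsMetricOn

/-! ### Pseudo Ricci symmetry and the quasi Einstein equation at one point. -/

namespace IsPRSOn

lemma smul_form_of_quasiEinstein (h : IsPRSOn O G a) (hu : u ∈ O)
    (hR : ∀ i j, ricci G i j u = A * G u i j + B * (η i u * η j u / normSq G η u)) (i : Fin n) :
    A * a i u = -(B / normSq G η u * ∑ j, η j u * raise G a u j) * η i u := by
  have h1 := h.sum_ricci_mul_raise hu i
  have h2 : ∀ j, ricci G i j u * raise G a u j = A * (G u i j * raise G a u j)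
      + B / normSq G η u * η i u * (η j u * raise G a u j) := fun j => by
    rw [hR]; ring
  simp only [h2, Finset.sum_add_distrib, ← Finset.mul_sum, h.sum_mul_raise hu] at h1
  linear_combination h1

/-- When A ≠ 0, a nonzero null vector of Ri must point along η, whose eigenvalue is A + B. The
pairing `p` of η and `a` is nonzero, for otherwise A a = 0. -/
lemma add_eq_zero_of_quasiEinstein (h : IsPRSOn O G a) (hu : u ∈ O) (hη : normSq G η u ≠ 0)
    (hR : ∀ i j, ricci G i j u = A * G u i j + B * (η i u * η j u / normSq G η u))
    (hA : A ≠ 0) (ha : ∃ i, a i u ≠ 0) : A + B = 0 := by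
  have h1 := h.smul_form_of_quasiEinstein hu hR
  set p := ∑ j, η j u * raise G a u j with hp
  have hp0 : p ≠ 0 := by
    intro h0
    obtain ⟨i, hi⟩ := ha
    have := h1 i
    rw [h0] at this
    simp [hA, hi] at this
  have h2 : A * p = -(B / normSq G η u * p) * normSq G η u := by
    have hpη : p = ∑ i, a i u * raise G η u i := by
      have := h.sum_mul_inv_mulVec (a := a) hu (fun j => η j u)
      rw [hp]
      simp only [mul_comm (η _ u)]
      exact this.symm
    calc A * p = ∑ i, A * a i u * raise G η u i := by
          rw [hpη, Finset.mul_sum]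
          exact Finset.sum_congr rfl fun i _ => by ring
      _ = _ := by
          simp only [h1]
          clear_value p
          simp only [mul_assoc _ (η _ u), ← Finset.mul_sum, ← IsMetricOn.normSq_eq]
  have h3 : -(B / normSq G η u * p) * normSq G η u = -(B * p) := by field_simp
  have h4 : (A + B) * p = 0 := by linear_combination h2 + h3
  exact (mul_eq_zero.1 h4).resolve_right hp0

lemma cotton_eq_zero_of_form (h : IsPRSOn O G a) (hn : 2 ≤ n) (hu : u ∈ O)
    (ha : ∀ i, a i u = 0) (i j k : Fin n) : cotton G i j k u = 0 := by
  rw [h.cotton_eq hn hu, ha, ha]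
  ring

/-- Where a ≠ 0, the scalar curvature nA + B with A + B = 0 gives ρ = A, and Ri - ρ g = B η⊗η/|η|².
As `a` is parallel to η, the two terms of `cotton_eq` cancel. -/
lemma cotton_eq_zero_of_quasiEinstein (h : IsPRSOn O G a) (hn : 2 ≤ n) (hu : u ∈ O)
    (hη : normSq G η u ≠ 0)
    (hR : ∀ i j, ricci G i j u = A * G u i j + B * (η i u * η j u / normSq G η u))
    (hA : A ≠ 0) (i j k : Fin n) : cotton G i j k u = 0 := by
  by_cases ha : ∃ i, a i u ≠ 0
  · have hAB := h.add_eq_zero_of_quasiEinstein hu hη hR hA ha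
    have hn' : ((n : ℝ) - 1) ≠ 0 := by
      have : (2 : ℝ) ≤ n := by exact_mod_cast hn
      linarith
    have hs : scalar G u / ((n : ℝ) - 1) = A := by
      rw [h.scalar_of_quasiEinstein hu hη hR, div_eq_iff hn']
      linear_combination hAB
    have h1 := h.smul_form_of_quasiEinstein hu hR
    rw [h.cotton_eq hn hu, hs, hR, hR]
    apply mul_left_cancel₀ hA
    linear_combination (B * (η i u * η j u / normSq G η u)) * h1 k
      - (B * (η i u * η k u / normSq G η u)) * h1 j
  · push Not at ha
    exact h.cotton_eq_zero_of_form hn hu ha i j k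

end IsPRSOn

end QuasiEinstein

/-! ### Invariance of the scalar curvature under changes of coordinates -/

section CoordinateChange

variable {n : ℕ} {O O' : Set (EuclideanSpace ℝ (Fin n))} {u : EuclideanSpace ℝ (Fin n)}
  {G G' : EuclideanSpace ℝ (Fin n) → Matrix (Fin n) (Fin n) ℝ}
  {φ : EuclideanSpace ℝ (Fin n) → EuclideanSpace ℝ (Fin n)}

open Matrix

/-- The Jacobian matrix `∂_i φ^p`. -/
noncomputable def jacobian (φ : EuclideanSpace ℝ (Fin n) → EuclideanSpace ℝ (Fin n))
    (u : EuclideanSpace ℝ (Fin n)) : Matrix (Fin n) (Fin n) ℝ :=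
  Matrix.of fun p i => pderiv i (fun v => φ v p) u

lemma smooth_coord (hφ : ContDiffOn ℝ ∞ φ O) (p : Fin n) :
    ContDiffOn ℝ ∞ (fun v => φ v p) O :=
  (EuclideanSpace.proj (𝕜 := ℝ) p).contDiff.comp_contDiffOn hφ

lemma smooth_jacobian (hO : IsOpen O) (hφ : ContDiffOn ℝ ∞ φ O) : MSmooth O (jacobian φ) :=
  fun p i => contDiffOn_pderiv hO (smooth_coord hφ p) i

lemma fderiv_single_apply (hφ : DifferentiableAt ℝ φ u) (i p : Fin n) :
    fderiv ℝ φ u (EuclideanSpace.single i 1) p = jacobian φ u p i := by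
  have := ((EuclideanSpace.proj (𝕜 := ℝ) p).hasFDerivAt (x := φ u)).comp u hφ.hasFDerivAt
  simp only [jacobian, Matrix.of_apply, pderiv]
  have h2 : HasFDerivAt (fun v => φ v p) ((EuclideanSpace.proj (𝕜 := ℝ) p).comp (fderiv ℝ φ u)) u :=
    this
  rw [h2.fderiv]
  rfl

/-- The chain rule. -/
lemma pderiv_comp {f : EuclideanSpace ℝ (Fin n) → ℝ} (hf : DifferentiableAt ℝ f (φ u))
    (hφ : DifferentiableAt ℝ φ u) (i : Fin n) :
    pderiv i (fun v => f (φ v)) u = ∑ p, jacobian φ u p i * pderiv p f (φ u) := by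
  have : pderiv i (fun v => f (φ v)) u =
      fderiv ℝ f (φ u) (fderiv ℝ φ u (EuclideanSpace.single i 1)) := by
    simp only [pderiv]
    rw [show (fun v => f (φ v)) = f ∘ φ from rfl, fderiv_comp u hf hφ]
    rfl
  rw [this, fderiv_apply_eq_sum]
  exact Finset.sum_congr rfl fun p _ => by rw [fderiv_single_apply hφ]

lemma mderiv_comp {X : EuclideanSpace ℝ (Fin n) → Matrix (Fin n) (Fin n) ℝ}
    (hX : EntryDiffAt X (φ u)) (hφ : DifferentiableAt ℝ φ u) (i : Fin n) :
    mderiv i (fun v => X (φ v)) u = ∑ p, jacobian φ u p i • mderiv p X (φ u) := by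
  ext a b
  simp only [Matrix.sum_apply, Matrix.smul_apply, smul_eq_mul, mderiv, Matrix.of_apply]
  exact pderiv_comp (hX a b) hφ i

/-- The metrics `G` and `G'` are related by the change of coordinates `φ`. -/
structure IsCoordChange (O O' : Set (EuclideanSpace ℝ (Fin n)))
    (G G' : EuclideanSpace ℝ (Fin n) → Matrix (Fin n) (Fin n) ℝ)
    (φ : EuclideanSpace ℝ (Fin n) → EuclideanSpace ℝ (Fin n)) : Prop where
  source : IsMetricOn O G
  target : IsMetricOn O' G'
  smooth : ContDiffOn ℝ ∞ φ O
  mapsTo : Set.MapsTo φ O O'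
  eq : ∀ v ∈ O, G v = (jacobian φ v)ᵀ * G' (φ v) * jacobian φ v

/-- The pulled back connection matrices `∂_i φ^p A'_p`. -/
noncomputable def pullConn (G' : EuclideanSpace ℝ (Fin n) → Matrix (Fin n) (Fin n) ℝ)
    (φ : EuclideanSpace ℝ (Fin n) → EuclideanSpace ℝ (Fin n)) (i : Fin n)
    (u : EuclideanSpace ℝ (Fin n)) : Matrix (Fin n) (Fin n) ℝ :=
  ∑ p, jacobian φ u p i • conn G' p (φ u)

namespace IsCoordChange

lemma diffAt (h : IsCoordChange O O' G G' φ) (hu : u ∈ O) : DifferentiableAt ℝ φ u :=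
  (h.smooth.contDiffAt (h.source.isOpen.mem_nhds hu)).differentiableAt (by simp)

/-- Since G = Jᵀ G' J is nondegenerate, J is invertible; an inverse of φ is not required. -/
lemma isUnit_det (h : IsCoordChange O O' G G' φ) (hu : u ∈ O) : IsUnit (jacobian φ u).det := by
  have h1 := h.source.det_ne_zero hu
  rw [h.eq u hu, Matrix.det_mul, Matrix.det_mul] at h1
  exact (right_ne_zero_of_mul h1).isUnit

lemma mul_inv (h : IsCoordChange O O' G G' φ) (hu : u ∈ O) :
    jacobian φ u * (jacobian φ u)⁻¹ = 1 :=
  Matrix.mul_nonsing_inv _ (h.isUnit_det hu)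

lemma inv_mul (h : IsCoordChange O O' G G' φ) (hu : u ∈ O) :
    (jacobian φ u)⁻¹ * jacobian φ u = 1 :=
  Matrix.nonsing_inv_mul _ (h.isUnit_det hu)

lemma jacobian_entryDiffAt (h : IsCoordChange O O' G G' φ) (hu : u ∈ O) :
    EntryDiffAt (jacobian φ) u :=
  (smooth_jacobian h.source.isOpen h.smooth).entryDiffAt h.source.isOpen hu

lemma mderiv_jacobian_comm (h : IsCoordChange O O' G G' φ) (hu : u ∈ O) (i p k : Fin n) :
    mderiv i (jacobian φ) u p k = mderiv k (jacobian φ) u p i :=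
  pderiv_comm h.source.isOpen hu (smooth_coord h.smooth p) i k

/-- The transformation law of the connection matrices. -/
lemma jacobian_mul_conn (h : IsCoordChange O O' G G' φ) (hu : u ∈ O) (i : Fin n) :
    jacobian φ u * conn G i u = mderiv i (jacobian φ) u + pullConn G' φ i u * jacobian φ u := by
  set J := jacobian φ u with hJ
  -- The connection predicted by the transformation law. It is torsion free and metric, so
  -- `conn_unique` identifies it.
  set B : Fin n → Matrix (Fin n) (Fin n) ℝ :=
    fun i => J⁻¹ * (mderiv i (jacobian φ) u + pullConn G' φ i u * J) with hB
  have hJB : ∀ i, J * B i = mderiv i (jacobian φ) u + pullConn G' φ i u * J := fun i => by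
    rw [hB, ← Matrix.mul_assoc, h.mul_inv hu, Matrix.one_mul]
  have hu' := h.mapsTo hu
  have hsymm : ∀ i k l, B i l k = B k l i := by
    intro i k l
    have : ∀ i k p, (pullConn G' φ i u * J) p k =
        ∑ q, ∑ r, J q i * J r k * christoffel G' p q r (φ u) := by
      intro i k p
      simp only [pullConn, Matrix.mul_apply, Matrix.sum_apply, Matrix.smul_apply, smul_eq_mul,
        Finset.sum_mul, conn_apply]
      rw [Finset.sum_comm]
      exact Finset.sum_congr rfl fun q _ => Finset.sum_congr rfl fun r _ => by rw [hJ]; ring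
    simp only [hB]
    rw [Matrix.mul_apply, Matrix.mul_apply]
    simp only [Matrix.add_apply, this]
    refine Finset.sum_congr rfl fun p _ => ?_
    rw [h.mderiv_jacobian_comm hu i p k]
    congr 2
    rw [Finset.sum_comm]
    refine Finset.sum_congr rfl fun q _ => Finset.sum_congr rfl fun r _ => ?_
    rw [h.target.christoffel_comm hu' p r q]
    ring
  have hcompat : ∀ i, mderiv i G u = G u * B i + (B i)ᵀ * G u := by
    intro i
    have hJd := h.jacobian_entryDiffAt hu
    have hGd : EntryDiffAt G' (φ u) := h.target.smooth.entryDiffAt h.target.isOpen hu'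
    have hGφ : EntryDiffAt (fun v => G' (φ v)) u := fun a b => (hGd a b).comp u (h.diffAt hu)
    have hpull : mderiv i (fun v => G' (φ v)) u =
        G' (φ u) * pullConn G' φ i u + (pullConn G' φ i u)ᵀ * G' (φ u) := by
      rw [mderiv_comp hGd (h.diffAt hu)]
      simp only [h.target.mderiv_metric hu', pullConn, Matrix.transpose_sum,
        Matrix.transpose_smul, Finset.mul_sum, Finset.sum_mul, smul_add, Finset.sum_add_distrib,
        Matrix.mul_smul, Matrix.smul_mul]
    rw [mderiv_congr i h.source.isOpen hu h.eq,
      mderiv_mul i (hJd.transpose.mul hGφ) hJd, mderiv_mul i hJd.transpose hGφ, hpull,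
      mderiv_transpose, h.eq u hu]
    simp only [← hJ]
    have e1 : Jᵀ * G' (φ u) * J * B i = Jᵀ * G' (φ u) * (J * B i) := by noncomm_ring
    have e2 : (B i)ᵀ * (Jᵀ * G' (φ u) * J) = (J * B i)ᵀ * G' (φ u) * J := by
      rw [Matrix.transpose_mul J (B i)]; noncomm_ring
    rw [e1, e2, hJB, Matrix.transpose_add, Matrix.transpose_mul]
    noncomm_ring
  rw [h.source.conn_unique hu hsymm hcompat, hJB]

lemma mderiv_pullConn (h : IsCoordChange O O' G G' φ) (hu : u ∈ O) (i j : Fin n) :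
    mderiv i (pullConn G' φ j) u =
      ∑ p, mderiv i (jacobian φ) u p j • conn G' p (φ u)
      + ∑ q, ∑ p, (jacobian φ u q i * jacobian φ u p j) • mderiv q (conn G' p) (φ u) := by
  have hu' := h.mapsTo hu
  have hJd := h.jacobian_entryDiffAt hu
  have hA : ∀ p, EntryDiffAt (conn G' p) (φ u) := fun p =>
    (h.target.smooth_conn p).entryDiffAt h.target.isOpen hu'
  have hAφ : ∀ p a b, DifferentiableAt ℝ (fun v => conn G' p (φ v) a b) u := fun p a b =>
    (hA p a b).comp u (h.diffAt hu)
  ext a b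
  have h1 : (fun v => pullConn G' φ j v a b) =
      fun v => ∑ p, jacobian φ v p j * conn G' p (φ v) a b := by
    ext v
    simp [pullConn, Matrix.sum_apply]
  simp only [mderiv, Matrix.of_apply, h1, Matrix.add_apply, Matrix.sum_apply, Matrix.smul_apply,
    smul_eq_mul]
  rw [pderiv_sum _ _ fun p _ => (hJd p j).fun_mul (hAφ p a b), Finset.sum_comm,
    ← Finset.sum_add_distrib]
  refine Finset.sum_congr rfl fun p _ => ?_
  rw [pderiv_mul _ (hJd p j) (hAφ p a b), pderiv_comp (hA p a b) (h.diffAt hu), Finset.mul_sum]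
  congr 1
  exact Finset.sum_congr rfl fun q _ => by ring

/-- The transformation law of the curvature matrices. -/
lemma jacobian_mul_curv (h : IsCoordChange O O' G G' φ) (hu : u ∈ O) (i j : Fin n) :
    jacobian φ u * curv (conn G) i j u =
      (∑ q, ∑ p, (jacobian φ u q i * jacobian φ u p j) • curv (conn G') q p (φ u))
        * jacobian φ u := by
  have hu' := h.mapsTo hu
  have hJd := h.jacobian_entryDiffAt hu
  have hO := h.source.isOpen
  have hJs := smooth_jacobian hO h.smooth
  have hA : ∀ i, EntryDiffAt (conn G i) u := fun i => (h.source.smooth_conn i).entryDiffAt hO hu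
  have hP : ∀ j, EntryDiffAt (pullConn G' φ j) u := by
    intro j a b
    have h1 : (fun v => pullConn G' φ j v a b) =
        fun v => ∑ p, jacobian φ v p j * conn G' p (φ v) a b := by
      ext v
      simp [pullConn, Matrix.sum_apply]
    rw [h1]
    exact DifferentiableAt.fun_sum fun p _ => (hJd p j).fun_mul
      (((h.target.smooth_conn p).entryDiffAt h.target.isOpen hu' a b).comp u (h.diffAt hu))
  have hdd : ∀ j, EntryDiffAt (mderiv j (jacobian φ)) u := fun j =>
    (hJs.mderiv hO j).entryDiffAt hO hu
  -- The transformation law of the connection, differentiated. The second derivatives of the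
  -- Jacobian disappear on antisymmetrising in `i` and `j`.
  have hd : ∀ i j, mderiv i (jacobian φ) u * conn G j u + jacobian φ u * mderiv i (conn G j) u =
      mderiv i (mderiv j (jacobian φ)) u + (mderiv i (pullConn G' φ j) u * jacobian φ u
        + pullConn G' φ j u * mderiv i (jacobian φ) u) := by
    intro i j
    rw [← mderiv_mul i hJd (hA j), ← mderiv_mul i (hP j) hJd,
      ← mderiv_add i (hdd j) ((hP j).mul hJd)]
    exact mderiv_congr i hO hu fun v hv => h.jacobian_mul_conn hv j
  have hpull : ∑ q, ∑ p, (jacobian φ u q i * jacobian φ u p j) • curv (conn G') q p (φ u) =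
      mderiv i (pullConn G' φ j) u - mderiv j (pullConn G' φ i) u
        + pullConn G' φ i u * pullConn G' φ j u - pullConn G' φ j u * pullConn G' φ i u := by
    have e1 : ∀ i j, pullConn G' φ i u * pullConn G' φ j u = ∑ q, ∑ p,
        (jacobian φ u q i * jacobian φ u p j) • (conn G' q (φ u) * conn G' p (φ u)) := by
      intro i j
      simp only [pullConn, Finset.sum_mul, Finset.mul_sum, Matrix.smul_mul, Matrix.mul_smul,
        smul_smul]
      rw [Finset.sum_comm]
      exact Finset.sum_congr rfl fun q _ => Finset.sum_congr rfl fun p _ => by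
        rw [mul_comm (jacobian φ u p j)]
    have e2 : ∑ q, ∑ p, (jacobian φ u q j * jacobian φ u p i) • mderiv q (conn G' p) (φ u) =
        ∑ q, ∑ p, (jacobian φ u q i * jacobian φ u p j) • mderiv p (conn G' q) (φ u) := by
      rw [Finset.sum_comm]
      exact Finset.sum_congr rfl fun q _ => Finset.sum_congr rfl fun p _ => by rw [mul_comm]
    have e3 : ∑ q, ∑ p, (jacobian φ u q j * jacobian φ u p i) •
          (conn G' q (φ u) * conn G' p (φ u)) =
        ∑ q, ∑ p, (jacobian φ u q i * jacobian φ u p j) •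
          (conn G' p (φ u) * conn G' q (φ u)) := by
      rw [Finset.sum_comm]
      exact Finset.sum_congr rfl fun q _ => Finset.sum_congr rfl fun p _ => by rw [mul_comm]
    have e4 : ∀ p, mderiv i (jacobian φ) u p j = mderiv j (jacobian φ) u p i := fun p =>
      h.mderiv_jacobian_comm hu i p j
    rw [h.mderiv_pullConn hu, h.mderiv_pullConn hu, e1, e1, e2, e3]
    simp only [curv, e4, smul_add, smul_sub, Finset.sum_add_distrib, Finset.sum_sub_distrib]
    abel
  rw [hpull]
  have hi := h.jacobian_mul_conn hu i
  have hj := h.jacobian_mul_conn hu j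
  have hdij := hd i j
  have hdji := hd j i
  rw [mderiv_comm hO hu hJs i j] at hdij
  have a1 : jacobian φ u * mderiv i (conn G j) u =
      mderiv j (mderiv i (jacobian φ)) u + (mderiv i (pullConn G' φ j) u * jacobian φ u
        + pullConn G' φ j u * mderiv i (jacobian φ) u) - mderiv i (jacobian φ) u * conn G j u :=
    eq_sub_of_add_eq' hdij
  have a2 : jacobian φ u * mderiv j (conn G i) u =
      mderiv j (mderiv i (jacobian φ)) u + (mderiv j (pullConn G' φ i) u * jacobian φ u
        + pullConn G' φ i u * mderiv j (jacobian φ) u) - mderiv j (jacobian φ) u * conn G i u :=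
    eq_sub_of_add_eq' hdji
  have a3 : jacobian φ u * (conn G i u * conn G j u) = mderiv i (jacobian φ) u * conn G j u
      + pullConn G' φ i u * (mderiv j (jacobian φ) u + pullConn G' φ j u * jacobian φ u) := by
    rw [← Matrix.mul_assoc, hi, Matrix.add_mul, Matrix.mul_assoc, hj]
  have a4 : jacobian φ u * (conn G j u * conn G i u) = mderiv j (jacobian φ) u * conn G i u
      + pullConn G' φ j u * (mderiv i (jacobian φ) u + pullConn G' φ i u * jacobian φ u) := by
    rw [← Matrix.mul_assoc, hj, Matrix.add_mul, Matrix.mul_assoc, hi]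
  rw [curv, Matrix.mul_sub, Matrix.mul_add, Matrix.mul_sub, a1, a2, a3, a4]
  noncomm_ring

/-- The transformation law of the Ricci tensor. -/
lemma ricciMatrix_eq (h : IsCoordChange O O' G G' φ) (hu : u ∈ O) :
    ricciMatrix G u = (jacobian φ u)ᵀ * ricciMatrix G' (φ u) * jacobian φ u := by
  set J := jacobian φ u with hJ
  have hcurv : ∀ i j, curv (conn G) i j u =
      ∑ q, ∑ p, (J q i * J p j) • (J⁻¹ * curv (conn G') q p (φ u) * J) := by
    intro i j
    have := congrArg (fun X => J⁻¹ * X) (h.jacobian_mul_curv hu i j)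
    simp only [← Matrix.mul_assoc] at this
    rw [h.inv_mul hu, Matrix.one_mul] at this
    rw [this]
    simp only [Finset.mul_sum, Finset.sum_mul, Matrix.mul_smul, Matrix.smul_mul, hJ]
  -- J J⁻¹ = 1 trades the traced index `i` of the source for an index of the target.
  have hJJ : ∀ (X : Matrix (Fin n) (Fin n) ℝ) q k, ∑ i, J q i * (J⁻¹ * X) i k = X q k := by
    intro X q k
    rw [← Matrix.mul_apply, ← Matrix.mul_assoc, h.mul_inv hu, Matrix.one_mul]
  ext j k
  have hl : ricciMatrix G u j k = ∑ p, ∑ q, J p j * (curv (conn G') q p (φ u) * J) q k := by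
    rw [ricciMatrix_apply, ricci_eq_sum_curv]
    simp only [hcurv, Matrix.sum_apply, Matrix.smul_apply, smul_eq_mul]
    rw [Finset.sum_comm]
    have : ∀ q, ∑ i, ∑ p, J q i * J p j * (J⁻¹ * curv (conn G') q p (φ u) * J) i k =
        ∑ p, J p j * (curv (conn G') q p (φ u) * J) q k := by
      intro q
      rw [Finset.sum_comm]
      refine Finset.sum_congr rfl fun p _ => ?_
      rw [← hJJ (curv (conn G') q p (φ u) * J) q k, Finset.mul_sum]
      exact Finset.sum_congr rfl fun i _ => by rw [Matrix.mul_assoc]; ring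
    simp only [this]
    rw [Finset.sum_comm]
  rw [hl, Matrix.mul_assoc, Matrix.mul_apply]
  refine Finset.sum_congr rfl fun p _ => ?_
  rw [← Finset.mul_sum, Matrix.transpose_apply, Matrix.mul_apply]
  congr 1
  simp only [Matrix.mul_apply, ricciMatrix_apply, ricci_eq_sum_curv, Finset.sum_mul]
  rw [Finset.sum_comm]

/-- The scalar curvature is invariant under changes of coordinates. -/
lemma scalar_eq (h : IsCoordChange O O' G G' φ) (hu : u ∈ O) : scalar G u = scalar G' (φ u) := by
  have hu' := h.mapsTo hu
  rw [h.source.scalar_eq_trace hu, h.target.scalar_eq_trace hu', h.ricciMatrix_eq hu, h.eq u hu,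
    Matrix.mul_inv_rev, Matrix.mul_inv_rev, ← Matrix.transpose_nonsing_inv]
  set J := jacobian φ u with hJ
  have hJt : (J⁻¹)ᵀ * Jᵀ = 1 := by
    rw [← Matrix.transpose_mul, h.mul_inv hu, Matrix.transpose_one]
  have : J⁻¹ * ((G' (φ u))⁻¹ * (J⁻¹)ᵀ) * (Jᵀ * ricciMatrix G' (φ u) * J) =
      J⁻¹ * ((G' (φ u))⁻¹ * ((J⁻¹)ᵀ * Jᵀ) * ricciMatrix G' (φ u) * J) := by noncomm_ring
  rw [this, hJt, Matrix.mul_one, Matrix.trace_mul_comm, Matrix.mul_assoc, h.mul_inv hu,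
    Matrix.mul_one]

end IsCoordChange

end CoordinateChange

/-! ### Coordinate systems of a manifold -/

section Linear

variable {n : ℕ} {F : Type*} [NormedAddCommGroup F] [NormedSpace ℝ F]

lemma clm_apply_eq_sum (L : EuclideanSpace ℝ (Fin n) →L[ℝ] F) (x : EuclideanSpace ℝ (Fin n)) :
    L x = ∑ i, x i • L (EuclideanSpace.single i (1 : ℝ)) := by
  conv_lhs => rw [← (EuclideanSpace.basisFun (Fin n) ℝ).sum_repr x]
  simp

lemma clm_apply_sum_sum (B : F →L[ℝ] F →L[ℝ] ℝ) (c : Fin n → F) (x y : Fin n → ℝ) :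
    B (∑ i, x i • c i) (∑ i, y i • c i) = ∑ i, ∑ j, x i * B (c i) (c j) * y j := by
  simp only [map_sum, map_smul, sum_apply, smul_apply, smul_eq_mul]
  simp only [Finset.mul_sum]
  rw [Finset.sum_comm]
  exact Finset.sum_congr rfl fun i _ => Finset.sum_congr rfl fun j _ => by ring

end Linear

section Manifold

variable {n : ℕ} {M : Type*} [TopologicalSpace M] [ChartedSpace (EuclideanSpace ℝ (Fin n)) M]
  {e e' : OpenPartialHomeomorph M (EuclideanSpace ℝ (Fin n))}
  {u : EuclideanSpace ℝ (Fin n)}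

lemma mdifferentiable_of_mem_maximalAtlas (he : e ∈ IsManifold.maximalAtlas (𝓡 n) ∞ M) :
    e.MDifferentiable (𝓡 n) (𝓡 n) :=
  ⟨(contMDiffOn_of_mem_maximalAtlas he).mdifferentiableOn (by simp),
    (contMDiffOn_symm_of_mem_maximalAtlas he).mdifferentiableOn (by simp)⟩

/-- The derivative of the inverse of a coordinate system, in the model space. -/
noncomputable def symmDeriv (e : OpenPartialHomeomorph M (EuclideanSpace ℝ (Fin n)))
    (u : EuclideanSpace ℝ (Fin n)) : EuclideanSpace ℝ (Fin n) →L[ℝ] EuclideanSpace ℝ (Fin n) :=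
  mfderiv (𝓡 n) (𝓡 n) e.symm u

/-- A one form at `x` as a linear form on the model space. -/
def formModel (α : (x : M) → TangentSpace (𝓡 n) x →L[ℝ] ℝ) (x : M) :
    EuclideanSpace ℝ (Fin n) →L[ℝ] ℝ :=
  α x

lemma formCoeff_eq (α : (x : M) → TangentSpace (𝓡 n) x →L[ℝ] ℝ)
    (e : OpenPartialHomeomorph M (EuclideanSpace ℝ (Fin n))) (u : EuclideanSpace ℝ (Fin n))
    (i : Fin n) :
    formCoeff α e i u = formModel α (e.symm u) (symmDeriv e u (EuclideanSpace.single i 1)) := rfl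

lemma symmDeriv_injective (he : e ∈ IsManifold.maximalAtlas (𝓡 n) ∞ M) (hu : u ∈ e.target) :
    Function.Injective (symmDeriv e u) :=
  (mdifferentiable_of_mem_maximalAtlas he).symm.mfderiv_injective hu

lemma symmDeriv_surjective (he : e ∈ IsManifold.maximalAtlas (𝓡 n) ∞ M) (hu : u ∈ e.target) :
    Function.Surjective (symmDeriv e u) :=
  (mdifferentiable_of_mem_maximalAtlas he).symm.mfderiv_surjective hu

lemma symmDeriv_change (he : e ∈ IsManifold.maximalAtlas (𝓡 n) ∞ M)
    (he' : e' ∈ IsManifold.maximalAtlas (𝓡 n) ∞ M) (hu : u ∈ e.target)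
    (hu' : e.symm u ∈ e'.source) (i : Fin n) :
    symmDeriv e u (EuclideanSpace.single i 1) = ∑ p, jacobian (fun v => e' (e.symm v)) u p i •
        symmDeriv e' (e' (e.symm u)) (EuclideanSpace.single p 1) := by
  have hm := mdifferentiable_of_mem_maximalAtlas he
  have hm' := mdifferentiable_of_mem_maximalAtlas he'
  have hφm : MDifferentiableAt (𝓡 n) (𝓡 n) (fun v => e' (e.symm v)) u :=
    (hm'.mdifferentiableAt hu').comp u (hm.mdifferentiableAt_symm hu)
  have hφ : DifferentiableAt ℝ (fun v => e' (e.symm v)) u :=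
    mdifferentiableAt_iff_differentiableAt.1 hφm
  have hev : e.symm =ᶠ[nhds u] e'.symm ∘ fun v => e' (e.symm v) := by
    have : e.symm ⁻¹' e'.source ∈ nhds u :=
      (e.continuousAt_symm hu).preimage_mem_nhds (e'.open_source.mem_nhds hu')
    filter_upwards [this] with v hv
    exact (e'.left_inv hv).symm
  have h1 : symmDeriv e u =
      (symmDeriv e' (e' (e.symm u))).comp (fderiv ℝ (fun v => e' (e.symm v)) u) := by
    have h2 := hev.mfderiv_eq (I := 𝓡 n) (I' := 𝓡 n)
    have h3 := mfderiv_comp u (hm'.mdifferentiableAt_symm (e'.map_source hu')) hφm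
    rw [mfderiv_eq_fderiv] at h3
    exact h2.trans h3
  rw [h1, ContinuousLinearMap.comp_apply, clm_apply_eq_sum (symmDeriv e' (e' (e.symm u)))]
  exact Finset.sum_congr rfl fun p _ => by rw [fderiv_single_apply hφ]

/-- The coordinate vectors span the tangent space, as the derivative of `e.symm` is surjective. -/
lemma form_eq_zero_iff {α : (x : M) → TangentSpace (𝓡 n) x →L[ℝ] ℝ}
    (he : e ∈ IsManifold.maximalAtlas (𝓡 n) ∞ M) (hu : u ∈ e.target) :
    α (e.symm u) = 0 ↔ ∀ i, formCoeff α e i u = 0 := by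
  have hm : α (e.symm u) = 0 ↔ formModel α (e.symm u) = 0 := Iff.rfl
  rw [hm]
  constructor
  · intro h i
    rw [formCoeff_eq, h]
    rfl
  · intro h
    ext y
    obtain ⟨x, rfl⟩ := symmDeriv_surjective he hu y
    rw [clm_apply_eq_sum (symmDeriv e u), map_sum]
    simp only [map_smul, ← formCoeff_eq, h]
    simp

variable [IsManifold (𝓡 n) ∞ M]

/-- The coordinate field is the tangent map of `e.symm` applied to a constant vector field. -/
lemma contMDiffOn_coordVec (he : e ∈ IsManifold.maximalAtlas (𝓡 n) ∞ M) (i : Fin n) :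
    ContMDiffOn (𝓡 n) ((𝓡 n).prod 𝓘(ℝ, EuclideanSpace ℝ (Fin n))) ∞
      (fun v => TotalSpace.mk' (EuclideanSpace ℝ (Fin n))
        (E := fun x : M => TangentSpace (𝓡 n) x) (e.symm v) (coordVec e i v)) e.target := by
  have hs := contMDiffOn_symm_of_mem_maximalAtlas he
  have hT := hs.contMDiffOn_tangentMapWithin (m := ∞) (by simp) e.open_target.uniqueMDiffOn
  have hσ : ContMDiff (𝓡 n) (𝓡 n).tangent ∞
      (fun v : EuclideanSpace ℝ (Fin n) => (⟨v, (EuclideanSpace.single i (1 : ℝ) :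
        EuclideanSpace ℝ (Fin n))⟩ : TangentBundle (𝓡 n) (EuclideanSpace ℝ (Fin n)))) :=
    contMDiff_vectorSpace_iff_contDiff.2 contDiff_const
  have hc := hT.comp hσ.contMDiffOn (s := e.target) fun v hv => hv
  refine hc.congr fun v hv => ?_
  simp only [Function.comp, tangentMapWithin, coordVec]
  rw [mfderivWithin_of_isOpen e.open_target hv]

lemma smooth_metricCoeff (g : ContMDiffRiemannianMetric (𝓡 n) ∞ (EuclideanSpace ℝ (Fin n))
    (fun x : M => TangentSpace (𝓡 n) x)) (he : e ∈ IsManifold.maximalAtlas (𝓡 n) ∞ M) :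
    MSmooth e.target (metricCoeff g e) := by
  intro i j
  rw [← contMDiffOn_iff_contDiffOn]
  have hg := g.contMDiff.comp_contMDiffOn (contMDiffOn_symm_of_mem_maximalAtlas he)
  have := ContMDiffOn.clm_bundle_apply₂ (F₁ := EuclideanSpace ℝ (Fin n))
    (F₂ := EuclideanSpace ℝ (Fin n)) (F₃ := ℝ) (E₃ := Bundle.Trivial M ℝ) hg
    (contMDiffOn_coordVec he i) (contMDiffOn_coordVec he j)
  intro v hv
  have h2 := this v hv
  simp only [contMDiffWithinAt_totalSpace] at h2
  exact h2.2

lemma smooth_formCoeff {α : (x : M) → TangentSpace (𝓡 n) x →L[ℝ] ℝ} (hα : SmoothForm α)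
    (he : e ∈ IsManifold.maximalAtlas (𝓡 n) ∞ M) (i : Fin n) :
    ContDiffOn ℝ ∞ (formCoeff α e i) e.target := by
  rw [← contMDiffOn_iff_contDiffOn]
  have hg := ContMDiff.comp_contMDiffOn hα (contMDiffOn_symm_of_mem_maximalAtlas he)
  have := ContMDiffOn.clm_bundle_apply (F₁ := EuclideanSpace ℝ (Fin n))
    (F₂ := ℝ) (E₂ := Bundle.Trivial M ℝ) hg (contMDiffOn_coordVec he i)
  intro v hv
  have h2 := this v hv
  simp only [contMDiffWithinAt_totalSpace] at h2
  exact h2.2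

/-- The metric at `x` as a bilinear form on the model space. -/
def innerModel (g : ContMDiffRiemannianMetric (𝓡 n) ∞ (EuclideanSpace ℝ (Fin n))
    (fun x : M => TangentSpace (𝓡 n) x)) (x : M) :
    EuclideanSpace ℝ (Fin n) →L[ℝ] EuclideanSpace ℝ (Fin n) →L[ℝ] ℝ :=
  g.inner x

lemma metricCoeff_apply (g : ContMDiffRiemannianMetric (𝓡 n) ∞ (EuclideanSpace ℝ (Fin n))
    (fun x : M => TangentSpace (𝓡 n) x)) (e : OpenPartialHomeomorph M (EuclideanSpace ℝ (Fin n)))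
    (u : EuclideanSpace ℝ (Fin n)) (i j : Fin n) :
    metricCoeff g e u i j = innerModel g (e.symm u) (symmDeriv e u (EuclideanSpace.single i 1))
      (symmDeriv e u (EuclideanSpace.single j 1)) := rfl

lemma innerModel_sum_sum (g : ContMDiffRiemannianMetric (𝓡 n) ∞ (EuclideanSpace ℝ (Fin n))
    (fun x : M => TangentSpace (𝓡 n) x)) (e : OpenPartialHomeomorph M (EuclideanSpace ℝ (Fin n)))
    (u : EuclideanSpace ℝ (Fin n)) (x y : Fin n → ℝ) :
    innerModel g (e.symm u) (∑ i, x i • symmDeriv e u (EuclideanSpace.single i 1))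
      (∑ i, y i • symmDeriv e u (EuclideanSpace.single i 1)) =
      ∑ i, ∑ j, x i * metricCoeff g e u i j * y j := by
  rw [clm_apply_sum_sum]
  simp only [metricCoeff_apply]

lemma isMetricOn_metricCoeff (g : ContMDiffRiemannianMetric (𝓡 n) ∞ (EuclideanSpace ℝ (Fin n))
    (fun x : M => TangentSpace (𝓡 n) x)) (he : e ∈ IsManifold.maximalAtlas (𝓡 n) ∞ M) :
    IsMetricOn e.target (metricCoeff g e) := by
  refine ⟨e.open_target, smooth_metricCoeff g he, fun v hv => ?_⟩
  refine Matrix.PosDef.of_dotProduct_mulVec_pos ?_ fun x hx => ?_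
  · ext i j
    exact g.symm _ _ _
  · have h1 : innerModel g (e.symm v) (symmDeriv e v (WithLp.toLp 2 x))
        (symmDeriv e v (WithLp.toLp 2 x)) = star x ⬝ᵥ (metricCoeff g e v).mulVec x := by
      rw [clm_apply_eq_sum (symmDeriv e v), innerModel_sum_sum]
      simp only [dotProduct, Matrix.mulVec, Finset.mul_sum, Pi.star_apply, star_trivial, mul_assoc]
    rw [← h1]
    refine g.pos _ _ fun h0 => hx ?_
    have := symmDeriv_injective he hv (h0.trans (map_zero (symmDeriv e v)).symm)
    exact (WithLp.toLp_eq_zero 2).1 this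

lemma normSq_formCoeff (g : ContMDiffRiemannianMetric (𝓡 n) ∞ (EuclideanSpace ℝ (Fin n))
    (fun x : M => TangentSpace (𝓡 n) x)) (α : (x : M) → TangentSpace (𝓡 n) x →L[ℝ] ℝ)
    (e : OpenPartialHomeomorph M (EuclideanSpace ℝ (Fin n))) (u : EuclideanSpace ℝ (Fin n)) :
    normSq (metricCoeff g e) (formCoeff α e) u = formNormSq g α e u := rfl

lemma isCoordChange (g : ContMDiffRiemannianMetric (𝓡 n) ∞ (EuclideanSpace ℝ (Fin n))
    (fun x : M => TangentSpace (𝓡 n) x)) (he : e ∈ IsManifold.maximalAtlas (𝓡 n) ∞ M)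
    (he' : e' ∈ IsManifold.maximalAtlas (𝓡 n) ∞ M) :
    IsCoordChange (e.target ∩ e.symm ⁻¹' e'.source) e'.target (metricCoeff g e) (metricCoeff g e')
      (fun v => e' (e.symm v)) where
  source := (isMetricOn_metricCoeff g he).mono
    (e.continuousOn_symm.isOpen_inter_preimage e.open_target e'.open_source)
    Set.inter_subset_left
  target := isMetricOn_metricCoeff g he'
  smooth := by
    rw [← contMDiffOn_iff_contDiffOn]
    exact (contMDiffOn_of_mem_maximalAtlas he').comp
      ((contMDiffOn_symm_of_mem_maximalAtlas he).mono Set.inter_subset_left) fun v hv => hv.2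
  mapsTo := fun v hv => e'.map_source hv.2
  eq := by
    intro v hv
    ext i j
    rw [metricCoeff_apply, symmDeriv_change he he' hv.1 hv.2 i,
      symmDeriv_change he he' hv.1 hv.2 j]
    have h1 := innerModel_sum_sum g e' (e' (e.symm v))
      (fun p => jacobian (fun v => e' (e.symm v)) v p i)
      (fun p => jacobian (fun v => e' (e.symm v)) v p j)
    rw [e'.left_inv hv.2] at h1
    rw [h1]
    simp only [Matrix.mul_apply, Matrix.transpose_apply, Finset.sum_mul]
    rw [Finset.sum_comm]

/-- The scalar curvature can be computed in any coordinate system. -/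
lemma scalarCurvature_eq (g : ContMDiffRiemannianMetric (𝓡 n) ∞ (EuclideanSpace ℝ (Fin n))
    (fun x : M => TangentSpace (𝓡 n) x)) (he : e ∈ IsManifold.maximalAtlas (𝓡 n) ∞ M)
    (hu : u ∈ e.target) : scalarCurvature g (e.symm u) = scalar (metricCoeff g e) u :=
  ((isCoordChange g he (IsManifold.chart_mem_maximalAtlas (e.symm u))).scalar_eq
    ⟨hu, mem_chart_source _ _⟩).symm

end Manifold

/-! ### Zero sets of solutions of `df = f β` -/

section ZeroSet

variable {n : ℕ}

/-- Restricted to a segment issuing from `u`, f satisfies |h'| ≤ r C |h| and h(0) = 0, where C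
bounds Σ |β_i| on a compact ball of radius r. Grönwall gives h = 0. -/
lemma eventually_eq_zero_of_pderiv_eq_mul {O : Set (EuclideanSpace ℝ (Fin n))}
    {u : EuclideanSpace ℝ (Fin n)} {f : EuclideanSpace ℝ (Fin n) → ℝ}
    {β : Fin n → EuclideanSpace ℝ (Fin n) → ℝ} (hO : IsOpen O) (hu : u ∈ O)
    (hf : ContDiffOn ℝ ∞ f O) (hβ : ∀ i, ContinuousOn (β i) O)
    (hd : ∀ v ∈ O, ∀ i, pderiv i f v = f v * β i v) (h0 : f u = 0) :
    ∀ᶠ v in nhds u, f v = 0 := by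
  obtain ⟨r, hr, hball⟩ := Metric.nhds_basis_closedBall.mem_iff.1 (hO.mem_nhds hu)
  have hcont : ContinuousOn (fun v => ∑ i, |β i v|) (Metric.closedBall u r) :=
    continuousOn_finsetSum _ fun i _ => ((hβ i).mono hball).abs
  obtain ⟨C, hC⟩ := (isCompact_closedBall u r).bddAbove_image hcont
  have hC' : ∀ v ∈ Metric.closedBall u r, ∑ i, |β i v| ≤ C := fun v hv =>
    hC (Set.mem_image_of_mem _ hv)
  filter_upwards [Metric.closedBall_mem_nhds u hr] with v hv
  have hvr : ‖v - u‖ ≤ r := by rwa [Metric.mem_closedBall, dist_eq_norm] at hv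
  set γ : ℝ → EuclideanSpace ℝ (Fin n) := fun t => u + t • (v - u) with hγ
  have hγmem : ∀ t ∈ Set.Icc (0 : ℝ) 1, γ t ∈ Metric.closedBall u r := by
    intro t ht
    rw [Metric.mem_closedBall, dist_eq_norm, hγ]
    simp only [add_sub_cancel_left, norm_smul, Real.norm_eq_abs, abs_of_nonneg ht.1]
    nlinarith [ht.2, norm_nonneg (v - u)]
  have hγd : ∀ t, HasDerivAt γ (v - u) t := by
    intro t
    have h1 := ((hasDerivAt_id t).smul_const (v - u)).const_add u
    rw [one_smul] at h1
    exact h1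
  have hfd : ∀ t ∈ Set.Icc (0 : ℝ) 1,
      HasDerivAt (fun t => f (γ t)) (fderiv ℝ f (γ t) (v - u)) t := by
    intro t ht
    exact (hf.diffAt_of_isOpen hO (hball (hγmem t ht))).hasFDerivAt.comp_hasDerivAt t (hγd t)
  have hbound : ∀ t ∈ Set.Ico (0 : ℝ) 1,
      ‖fderiv ℝ f (γ t) (v - u)‖ ≤ (r * C) * ‖f (γ t)‖ := by
    intro t ht
    have hm := hγmem t ⟨ht.1, ht.2.le⟩
    rw [fderiv_apply_eq_sum]
    calc ‖∑ i, (v - u) i * pderiv i f (γ t)‖ ≤ ∑ i, ‖(v - u) i * pderiv i f (γ t)‖ :=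
          norm_sum_le _ _
      _ ≤ ∑ i, r * |β i (γ t)| * ‖f (γ t)‖ := by
          refine Finset.sum_le_sum fun i _ => ?_
          rw [hd _ (hball hm), norm_mul, norm_mul]
          have h1 : ‖(v - u) i‖ ≤ r := (PiLp.norm_apply_le (v - u) i).trans hvr
          have h2 : 0 ≤ ‖f (γ t)‖ * ‖β i (γ t)‖ := by positivity
          calc ‖(v - u) i‖ * (‖f (γ t)‖ * ‖β i (γ t)‖) ≤ r * (‖f (γ t)‖ * ‖β i (γ t)‖) :=
                mul_le_mul_of_nonneg_right h1 h2
            _ = r * |β i (γ t)| * ‖f (γ t)‖ := by rw [Real.norm_eq_abs (β i _)]; ring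
      _ = r * (∑ i, |β i (γ t)|) * ‖f (γ t)‖ := by rw [← Finset.sum_mul, ← Finset.mul_sum]
      _ ≤ (r * C) * ‖f (γ t)‖ := by
          have := hC' _ hm
          gcongr
  have hγ0 : γ 0 = u := by simp [hγ]
  have hγ1 : γ 1 = v := by simp [hγ]
  have := eq_zero_of_abs_deriv_le_mul_abs_self_of_eq_zero_right (f := fun t => f (γ t))
    (fun t ht => (hfd t ht).continuousAt.continuousWithinAt)
    (fun t ht => (hfd t ⟨ht.1, ht.2.le⟩).hasDerivWithinAt) (by simpa [hγ0] using h0) hbound 1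
    (by simp)
  simpa [hγ1] using this

variable {M : Type*} [TopologicalSpace M] [ChartedSpace (EuclideanSpace ℝ (Fin n)) M]

/-- A set which in each preferred chart is the zero set of a solution of `df = f β` is clopen. -/
lemma isClopen_of_pderiv_eq_mul {Z : Set M}
    (hZ : ∀ x : M, ∃ (f : EuclideanSpace ℝ (Fin n) → ℝ)
      (β : Fin n → EuclideanSpace ℝ (Fin n) → ℝ),
      ContDiffOn ℝ ∞ f (chartAt (EuclideanSpace ℝ (Fin n)) x).target ∧
      (∀ i, ContinuousOn (β i) (chartAt (EuclideanSpace ℝ (Fin n)) x).target) ∧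
      (∀ v ∈ (chartAt (EuclideanSpace ℝ (Fin n)) x).target, ∀ i, pderiv i f v = f v * β i v) ∧
      ∀ v ∈ (chartAt (EuclideanSpace ℝ (Fin n)) x).target,
        (chartAt (EuclideanSpace ℝ (Fin n)) x).symm v ∈ Z ↔ f v = 0) : IsClopen Z := by
  have key : ∀ x : M, (x ∈ Z → Z ∈ nhds x) ∧ (x ∉ Z → Zᶜ ∈ nhds x) := by
    intro x
    obtain ⟨f, β, hf, hβ, hd, hz⟩ := hZ x
    set e := chartAt (EuclideanSpace ℝ (Fin n)) x with he
    have hx : x ∈ e.source := mem_chart_source _ x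
    have hmem : ∀ y ∈ e.source, (y ∈ Z ↔ f (e y) = 0) := by
      intro y hy
      rw [← hz _ (e.map_source hy), e.left_inv hy]
    have hsrc : e.source ∈ nhds x := e.open_source.mem_nhds hx
    constructor
    · intro hxZ
      have h1 := eventually_eq_zero_of_pderiv_eq_mul e.open_target (e.map_source hx) hf hβ hd
        ((hmem x hx).1 hxZ)
      filter_upwards [hsrc, (e.continuousAt hx).eventually h1] with y hy hy0
      exact (hmem y hy).2 hy0
    · intro hxZ
      have h1 : ∀ᶠ v in nhds (e x), f v ≠ 0 :=
        (hf.continuousOn.continuousAt (e.open_target.mem_nhds (e.map_source hx))).eventually_ne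
          fun h0 => hxZ ((hmem x hx).2 h0)
      filter_upwards [hsrc, (e.continuousAt hx).eventually h1] with y hy hy0
      exact fun hyZ => hy0 ((hmem y hy).1 hyZ)
  exact ⟨⟨isOpen_iff_mem_nhds.2 fun x hx => (key x).2 hx⟩,
    isOpen_iff_mem_nhds.2 fun x hx => (key x).1 hx⟩

/-- A clopen set which misses a point of every connected component is empty. -/
lemma notMem_of_isClopen {Z : Set M} (hZ : IsClopen Z) {P : M → Prop}
    (hP : SomewhereOnComponents P) (h : ∀ x, P x → x ∉ Z) (x : M) : x ∉ Z := by
  intro hx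
  obtain ⟨y, hy, hPy⟩ := hP x
  exact h y hPy (hZ.connectedComponent_subset hx hy)

end ZeroSet

/-! ### The main theorem -/

section Main

variable {n : ℕ} {M : Type*} [TopologicalSpace M] [ChartedSpace (EuclideanSpace ℝ (Fin n)) M]
  [IsManifold (𝓡 n) ∞ M]
  {e : OpenPartialHomeomorph M (EuclideanSpace ℝ (Fin n))} {u : EuclideanSpace ℝ (Fin n)}
  {g : ContMDiffRiemannianMetric (𝓡 n) ∞ (EuclideanSpace ℝ (Fin n))
    (fun x : M => TangentSpace (𝓡 n) x)}
  {α : (x : M) → TangentSpace (𝓡 n) x →L[ℝ] ℝ}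

/-- The metric `g` is pseudo Ricci symmetric with one form `α`. -/
structure IsPRSWith (g : ContMDiffRiemannianMetric (𝓡 n) ∞ (EuclideanSpace ℝ (Fin n))
    (fun x : M => TangentSpace (𝓡 n) x)) (α : (x : M) → TangentSpace (𝓡 n) x →L[ℝ] ℝ) : Prop where
  smooth : SmoothForm α
  eq : ∀ e ∈ IsManifold.maximalAtlas (𝓡 n) ∞ M, ∀ u ∈ e.target, ∀ i j l : Fin n,
      covDeriv (metricCoeff g e) (ricci (metricCoeff g e)) i j l u =
        2 * formCoeff α e l u * ricci (metricCoeff g e) i j u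
          + formCoeff α e i u * ricci (metricCoeff g e) l j u
          + formCoeff α e j u * ricci (metricCoeff g e) i l u

namespace IsPRSWith

lemma isPRSOn (h : IsPRSWith g α) (he : e ∈ IsManifold.maximalAtlas (𝓡 n) ∞ M) :
    IsPRSOn e.target (metricCoeff g e) (formCoeff α e) :=
  ⟨isMetricOn_metricCoeff g he, fun i => smooth_formCoeff h.smooth he i, h.eq e he⟩

lemma continuousOn_const_mul_formCoeff (h : IsPRSWith g α)
    (he : e ∈ IsManifold.maximalAtlas (𝓡 n) ∞ M) (c : ℝ) (i : Fin n) :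
    ContinuousOn (fun v => c * formCoeff α e i v) e.target :=
  continuousOn_const.mul (smooth_formCoeff h.smooth he i).continuousOn

lemma scalarCurvature_ne_zero (h : IsPRSWith g α)
    (hsc : SomewhereOnComponents (fun x : M => scalarCurvature g x ≠ 0)) (x : M) :
    scalarCurvature g x ≠ 0 := by
  refine notMem_of_isClopen (Z := {x | scalarCurvature g x = 0})
    (isClopen_of_pderiv_eq_mul (n := n) fun x => ?_) hsc (fun x hx => hx) x
  have he := IsManifold.chart_mem_maximalAtlas (I := 𝓡 n) (n := ∞) x
  refine ⟨scalar (metricCoeff g (chartAt _ x)), fun i v => 2 * formCoeff α (chartAt _ x) i v,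
    (isMetricOn_metricCoeff g he).smooth_scalar, h.continuousOn_const_mul_formCoeff he 2,
    fun v hv i => (h.isPRSOn he).pderiv_scalar hv i, fun v hv => ?_⟩
  rw [Set.mem_ofPred_eq, scalarCurvature_eq g he hv]

/-- Apply the clopen argument to |α|², which satisfies d|α|² = 2 |α|² α by Cotton flatness. -/
lemma form_ne_zero (h : IsPRSWith g α) (hn : 2 ≤ n)
    (hα : SomewhereOnComponents (fun x : M => α x ≠ 0))
    (hsc : ∀ x, scalarCurvature g x ≠ 0) (hC : CottonFlat g) (x : M) : α x ≠ 0 := by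
  refine notMem_of_isClopen (Z := {x | α x = 0})
    (isClopen_of_pderiv_eq_mul (n := n) fun x => ?_) hα (fun x hx => hx) x
  have he := IsManifold.chart_mem_maximalAtlas (I := 𝓡 n) (n := ∞) x
  have hp := h.isPRSOn he
  refine ⟨normSq (metricCoeff g (chartAt _ x)) (formCoeff α (chartAt _ x)),
    fun i v => 2 * formCoeff α (chartAt _ x) i v, hp.smooth_normSq hp.smooth_form,
    h.continuousOn_const_mul_formCoeff he 2, fun v hv i => hp.pderiv_normSq_eq hn
      (fun v hv => ?_) (fun v hv => hC _ he v hv) hv i, fun v hv => ?_⟩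
  · rw [← scalarCurvature_eq g he hv]
    exact hsc _
  · rw [Set.mem_ofPred_eq, form_eq_zero_iff he hv, hp.normSq_eq_zero_iff hv]

end IsPRSWith

/-- Although the chart changes with the point, invariance lets the single chart at `x` compute sc on
a neighbourhood. -/
lemma contMDiff_scalarCurvature (g : ContMDiffRiemannianMetric (𝓡 n) ∞ (EuclideanSpace ℝ (Fin n))
    (fun x : M => TangentSpace (𝓡 n) x)) : ContMDiff (𝓡 n) 𝓘(ℝ, ℝ) ∞ (scalarCurvature g) := by
  intro x
  set e := chartAt (EuclideanSpace ℝ (Fin n)) x with hedef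
  have he : e ∈ IsManifold.maximalAtlas (𝓡 n) ∞ M := IsManifold.chart_mem_maximalAtlas x
  have hx : x ∈ e.source := mem_chart_source _ x
  have h1 : ContMDiffOn (𝓡 n) 𝓘(ℝ, ℝ) ∞ (fun y => scalar (metricCoeff g e) (e y)) e.source :=
    (contMDiffOn_iff_contDiffOn.2 (isMetricOn_metricCoeff g he).smooth_scalar).comp
      (contMDiffOn_of_mem_maximalAtlas he) fun y hy => e.map_source hy
  refine (h1.congr fun y hy => ?_).contMDiffAt (e.open_source.mem_nhds hx)
  rw [← scalarCurvature_eq g he (e.map_source hy), e.left_inv hy]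

lemma IsPRSWith.quasiEinstein (h : IsPRSWith g α) (hn : 2 ≤ n) (hα : ∀ x, α x ≠ 0)
    (hC : CottonFlat g) : QuasiEinstein g := by
  -- `normSq_mul_ricci` divided by |α|² reads Ri = ρ g - ρ α⊗α/|α|².
  refine ⟨fun x => ((n : ℝ) - 1)⁻¹ * scalarCurvature g x,
    fun x => -(((n : ℝ) - 1)⁻¹ * scalarCurvature g x), α,
    contMDiff_const.mul (contMDiff_scalarCurvature g),
    (contMDiff_const.mul (contMDiff_scalarCurvature g)).neg, h.smooth, hα, ?_⟩
  intro e he u hu i j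
  have hp := h.isPRSOn he
  have hF : normSq (metricCoeff g e) (formCoeff α e) u ≠ 0 := fun h0 =>
    hα _ ((form_eq_zero_iff he hu).2 ((hp.normSq_eq_zero_iff hu).1 h0))
  have h1 := hp.normSq_mul_ricci hn hu (hC e he u hu) i j
  beta_reduce
  rw [scalarCurvature_eq g he hu, ← normSq_formCoeff]
  apply mul_left_cancel₀ hF
  rw [h1]
  field_simp
  ring

lemma IsPRSWith.cottonFlat (h : IsPRSWith g α) (hn : 3 ≤ n)
    (hsc : ∀ x, scalarCurvature g x ≠ 0) {a b : M → ℝ} {η : (x : M) → TangentSpace (𝓡 n) x →L[ℝ] ℝ}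
    (hq : QuasiEinsteinWith g a b η) (ha : SomewhereOnComponents (fun x : M => a x ≠ 0)) :
    CottonFlat g := by
  obtain ⟨hac, hbc, -, hη, hR⟩ := hq
  have hηF : ∀ e ∈ IsManifold.maximalAtlas (𝓡 n) ∞ M, ∀ u ∈ e.target,
      normSq (metricCoeff g e) (formCoeff η e) u ≠ 0 := fun e he u hu h0 =>
    hη _ ((form_eq_zero_iff he hu).2 (((isMetricOn_metricCoeff g he).normSq_eq_zero_iff hu).1 h0))
  have hsc' : ∀ e ∈ IsManifold.maximalAtlas (𝓡 n) ∞ M, ∀ u ∈ e.target,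
      scalar (metricCoeff g e) u = n * a (e.symm u) + b (e.symm u) := fun e he u hu =>
    (isMetricOn_metricCoeff g he).scalar_of_quasiEinstein hu (hηF e he u hu) (hR e he u hu)
  have hq' : ∀ e ∈ IsManifold.maximalAtlas (𝓡 n) ∞ M, ∀ u ∈ e.target,
      ricciNormSq (metricCoeff g e) u = n * a (e.symm u) ^ 2 + 2 * a (e.symm u) * b (e.symm u)
        + b (e.symm u) ^ 2 := fun e he u hu =>
    (isMetricOn_metricCoeff g he).ricciNormSq_of_quasiEinstein hu (hηF e he u hu) (hR e he u hu)
  have hne : ∀ x, (n : ℝ) * a x + b x ≠ 0 := by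
    intro x
    have he := IsManifold.chart_mem_maximalAtlas (I := 𝓡 n) (n := ∞) x
    have := hsc' _ he _ (mem_chart_target _ x)
    rw [← scalarCurvature_eq g he (mem_chart_target _ x),
      (chartAt (EuclideanSpace ℝ (Fin n)) x).left_inv (mem_chart_source _ x)] at this
    rw [← this]
    exact hsc x
  have hn1 : ((n : ℝ) - 1) ≠ 0 := by
    have : (3 : ℝ) ≤ n := by exact_mod_cast hn
    linarith
  have hclopen : IsClopen {x : M | a x * (n * a x + 2 * b x) = 0} := by
    refine isClopen_of_pderiv_eq_mul (n := n) fun x => ?_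
    have he := IsManifold.chart_mem_maximalAtlas (I := 𝓡 n) (n := ∞) x
    have hp := h.isPRSOn he
    set e := chartAt (EuclideanSpace ℝ (Fin n)) x
    have hs := hp.smooth_scalar
    have hr : ContDiffOn ℝ ∞ (ricciNormSq (metricCoeff g e)) e.target :=
      ContDiffOn.sum fun j _ => ContDiffOn.sum fun k _ => (hp.smooth_inv j k).mul
        (((hp.smooth_ricci.mul hp.smooth_inv).mul hp.smooth_ricci) j k)
    -- Both |Ri|² and sc² solve df = 4 f α, hence so does their difference, which for a quasi
    -- Einstein tensor is -(n-1) a (na + 2b).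
    refine ⟨fun v => ricciNormSq (metricCoeff g e) v
      - scalar (metricCoeff g e) v * scalar (metricCoeff g e) v,
      fun i v => 4 * formCoeff α e i v, hr.sub (hs.mul hs),
      h.continuousOn_const_mul_formCoeff he 4, fun v hv i => ?_, fun v hv => ?_⟩
    · have hsd := hs.diffAt_of_isOpen e.open_target hv
      rw [pderiv_sub _ (hr.diffAt_of_isOpen e.open_target hv) (hsd.fun_mul hsd),
        pderiv_mul _ hsd hsd, hp.pderiv_scalar hv, hp.pderiv_ricciNormSq hv]
      ring
    · beta_reduce
      rw [Set.mem_ofPred_eq, hq' e he v hv, hsc' e he v hv]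
      have : n * a (e.symm v) ^ 2 + 2 * a (e.symm v) * b (e.symm v) + b (e.symm v) ^ 2
          - (n * a (e.symm v) + b (e.symm v)) * (n * a (e.symm v) + b (e.symm v)) =
          -((n : ℝ) - 1) * (a (e.symm v) * (n * a (e.symm v) + 2 * b (e.symm v))) := by ring
      rw [this]
      exact (mul_eq_zero.trans (or_iff_right (neg_ne_zero.2 hn1))).symm
  have hclopen' : IsClopen {x : M | a x = 0} := by
    have h1 : IsClosed {x : M | a x = 0} := isClosed_eq hac.continuous continuous_const
    -- A common zero of a and na + 2b would be a zero of b, hence of sc = na + b. So {a = 0} is a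
    -- clopen set intersected with an open one.
    have h2 : {x : M | a x = 0} =
        {x : M | a x * (n * a x + 2 * b x) = 0} ∩ {x : M | n * a x + 2 * b x ≠ 0} := by
      ext x
      simp only [Set.mem_ofPred_eq, Set.mem_inter_iff, mul_eq_zero]
      constructor
      · intro hx
        refine ⟨Or.inl hx, fun h0 => hne x ?_⟩
        rw [hx] at h0 ⊢
        linarith
      · rintro ⟨hx | hx, hx'⟩
        · exact hx
        · exact absurd hx hx'
    refine ⟨h1, ?_⟩
    rw [h2]
    exact hclopen.isOpen.inter (isOpen_ne_fun
      ((continuous_const.mul hac.continuous).add (continuous_const.mul hbc.continuous))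
      continuous_const)
  have hane : ∀ x, a x ≠ 0 := fun x =>
    notMem_of_isClopen hclopen' ha (fun x hx => hx) x
  intro e he u hu i j k
  exact (h.isPRSOn he).cotton_eq_zero_of_quasiEinstein (by omega) hu (hηF e he u hu)
    (hR e he u hu) (hane _) i j k

end Main

end RicciClasses

theorem mainTheorem7 (n : ℕ) (hn : 3 ≤ n)
    (M : Type*) [TopologicalSpace M] [T2Space M] [SecondCountableTopology M]
    [ChartedSpace (EuclideanSpace ℝ (Fin n)) M] [IsManifold (𝓡 n) ∞ M]
    (g : ContMDiffRiemannianMetric (𝓡 n) ∞ (EuclideanSpace ℝ (Fin n))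
      (fun x : M => TangentSpace (𝓡 n) x))
    (hprs : RicciClasses.PseudoRicciSymmetric g)
    (hsc : RicciClasses.SomewhereOnComponents
      (fun x : M => RicciClasses.scalarCurvature g x ≠ 0)) :
    ((∃ a b η, RicciClasses.QuasiEinsteinWith g a b η ∧
        RicciClasses.SomewhereOnComponents (fun x : M => a x ≠ 0)) →
      RicciClasses.CottonFlat g) ∧
    (RicciClasses.CottonFlat g → RicciClasses.QuasiEinstein g) := by
  obtain ⟨α, hα, hα0, heq⟩ := hprs
  have h : RicciClasses.IsPRSWith g α := ⟨hα, heq⟩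
  have hsc' := h.scalarCurvature_ne_zero hsc
  refine ⟨?_, fun hC => ?_⟩
  · rintro ⟨a, b, η, hq, ha⟩
    exact h.cottonFlat hn hsc' hq ha
  · exact h.quasiEinstein (by omega) (h.form_ne_zero (by omega) hα0 hsc' hC) hC
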